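/- **Setting.** A fair division instance consists of agents $[n]$, items $[m]$ and additive valuations $v_a(S)=\sum_{x\in S}v_a(x)$ with $v_a(x)\in[0,1]$ for all $a\in[n]$, $x\in[m]$. Put $\mathsf{PROP}_a=v_a([m])/n$. Agents arrive one after the other in an order $\tau=(\tau_1,\dots,\tau_n)$. On each arrival the items not yet taken are presented, divided into as many parts as there are agents still present; the arriving agent picks autonomously and rationally, i.e. takes a part of maximum value to her among those presented (ties broken arbitrarily), and leaves with it. The parts are formed by the following recursive rebundling algorithm. *Algorithm.* Let $U$ be the set of remaining items and let the remaining agents be renumbered $1,\dots,N$ in order of arrival. If $N=1$, present $U$. Otherwise let $M=(M[1],\dots,M[N])$ be the Round-Robin partition of $U$ with picking order $1,\dots,N$ (each pick is a most preferred available item, ties broken by least index), let $M[r,c]$ be the $r$-th pick of agent $c$, and let $\mathrm{mid}=\lfloor N/2\rfloor$. Call the items $M[r,c]$ with $r\in\{1,2\}$, $c>\mathrm{mid}$ that have not been moved the donor items. For $i=1,\dots,\mathrm{mid}$, when agent $i$ arrives: - if $i=\mathrm{mid}$, move all donor items to $M[i]$ and present the unpicked parts of $M$; - if $i<\mathrm{mid}$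 and agent $i$ values some donor item positively, move the first such item (in index order) to $M[i]$ and present the unpicked parts of $M$; - otherwise present the unpicked parts of the temporary partition $M'$ obtained from $M$ by exchanging the top items $M[1,i+k]$ and $M[1,\mathrm{mid}+k]$ for $k=1,\dots,\mathrm{mid}-i$ (a top item that was moved earlier counts as absent), and return to $M$ after the pick. Then recurse on the items of the unpicked parts and the agents $\mathrm{mid}+1,\dots,N$. (If an agent $i$ takes a part other than the $i$-th one, a temporary partition that she was shown is kept, and from then on the stage omits moves from or into parts that are already taken.) Let $g=g_n:[n]\to\mathbb N$ give the stage of the recursion in which the agent in position $i$ picks: $g_1(1)=1$ and, for $n\ge2$, $g_n(i)=1$ if $i\le\lfloor n/2\rfloor$, and $g_n(i)=1+g_{n-\lfloor n/2\rfloor}(i-\lfloor n/2\rfloor)$ if $i>\lfloor n/2\rfloor$. **Statement.** For every fair division instance there is an arrival order $\tau$ such that, when the agents arrive in the order $\tau$ and pick autonomously and rationally from the parts presented by the algorithm, for each $i\in[n]$ the agent $\tau_i$ gets a part of value at least $$\mathsf{PROP}_{\tau_i}-2g(i)-2 .$$ Moreover, $\tau$ can be computed in polynomial time: there are one program and one polynomial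 $T$ such that, for every instance with $n$ agents and $m$ items, the program computes such a $\tau$ from the matrix $(v_a(x))_{a,x}$ in at most $T(n+m)$ steps on a random access machine whose steps are additions, subtractions and comparisons of numbers (real or natural), constants, and indirect memory accesses. -/

import Mathlib

open scoped BigOperators

noncomputable section

/-- A fair division instance with `n` agents and `m` items: additive non-negative valuations,
normalised so that every single item is worth at most `1` to every agent. -/
structure FairInstance (n m : ℕ) where
  val : Fin n → Fin m → ℝ
  val_nonneg : ∀ a g, 0 ≤ val a g
  val_le_one : ∀ a g, val a g ≤ 1

/-- The recursive stage in which the agent arriving at position `i` (counted from `1`) among `n`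
agents picks. With a single agent left there is only one stage. -/
def stageOf (n i : ℕ) : ℕ :=
  if n ≤ 1 then 1
  else if i ≤ n / 2 then 1
  else 1 + stageOf (n - n / 2) (i - n / 2)
termination_by n
decreasing_by omega

/-- How the agents choose: given the agent, the labels of the parts still on offer, and the content
of the part with each label, the label of the part that the agent takes. -/
abbrev ChoiceRule (n m : ℕ) : Type :=
  Fin n → Finset ℕ → (ℕ → Finset (Fin m)) → ℕ

namespace FairInstance

variable {n m : ℕ} (I : FairInstance n m)

/-- Additive value of a set of items. -/
def value (a : Fin n) (S : Finset (Fin m)) : ℝ := ∑ g ∈ S, I.val a g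

/-- Proportional share. -/
def prop (a : Fin n) : ℝ := I.value a Finset.univ / n

/-- Every agent takes a part of maximum value among those on offer. Ties are broken arbitrarily. -/
def Rational (choose : ChoiceRule n m) : Prop :=
  ∀ (a : Fin n) (A : Finset ℕ) (P : ℕ → Finset (Fin m)), A.Nonempty →
    choose a A P ∈ A ∧ ∀ q ∈ A, I.value a (P q) ≤ I.value a (P (choose a A P))

/-! ### Round-Robin -/

/-- A most preferred item of agent `a` in `U` (the one of least index, if there are several). -/
def topItem (a : Fin n) (U : Finset (Fin m)) : Option (Fin m) :=
  (List.finRange m).find? fun g => decide (g ∈ U ∧ ∀ h ∈ U, I.val a h ≤ I.val a g)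

/-- The items picked in the first `k` turns of Round-Robin from `U`, in order of picking. The agent
at the head of the list picks and then moves to the back. -/
def roundRobinAux : ℕ → List (Fin n) → Finset (Fin m) → List (Fin m)
  | 0, _, _ => []
  | _ + 1, [], _ => []
  | k + 1, a :: L, U =>
    match I.topItem a U with
    | none => []
    | some g => g :: roundRobinAux k (L ++ [a]) (U.erase g)

/-- Round-Robin on the items `U` with picking sequence `L`, as the list of picks. -/
def roundRobin (L : List (Fin n)) (U : Finset (Fin m)) : List (Fin m) :=
  I.roundRobinAux U.card L U

end FairInstance

/-! ### One stage of the rebundling algorithm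

Within a stage with `N` agents, parts carry the labels `0, …, N - 1`. A partition of the item set `U`
of the stage is a map `own` from items to labels, so that part `q` is `{g ∈ U | own g = q}`. The set
`A` holds the labels of the unpicked parts. The pick with index `t` in the list `picks` of Round-Robin
is the entry of the Round-Robin matrix in row `t / N` and column `t % N`. -/

/-- Row of an item in the Round-Robin matrix, counted from `0`. -/
def rrRow {m : ℕ} (N : ℕ) (picks : List (Fin m)) (g : Fin m) : ℕ := picks.idxOf g / N

/-- Column of an item in the Round-Robin matrix, counted from `0`. -/
def rrCol {m : ℕ} (N : ℕ) (picks : List (Fin m)) (g : Fin m) : ℕ := picks.idxOf g % N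

/-- Part `q` of a partition of `U`. -/
def partOf {m : ℕ} (U : Finset (Fin m)) (own : Fin m → ℕ) (q : ℕ) : Finset (Fin m) :=
  U.filter fun g => own g = q

/-- The item sits at its original place in the Round-Robin matrix, in an unpicked part. -/
def InPlace {m : ℕ} (N : ℕ) (picks : List (Fin m)) (U : Finset (Fin m)) (own : Fin m → ℕ)
    (A : Finset ℕ) (g : Fin m) : Prop :=
  g ∈ U ∧ own g = rrCol N picks g ∧ own g ∈ A

instance {m : ℕ} (N : ℕ) (picks : List (Fin m)) (U : Finset (Fin m)) (own : Fin m → ℕ)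
    (A : Finset ℕ) (g : Fin m) : Decidable (InPlace N picks U own A g) := by
  unfold InPlace; infer_instance

/-- A donor item: an item still in place in the top two rows of the columns `mid, …, N - 1`
of the agents who do not pick in this stage. -/
def IsDonor {m : ℕ} (N : ℕ) (picks : List (Fin m)) (U : Finset (Fin m)) (own : Fin m → ℕ)
    (A : Finset ℕ) (g : Fin m) : Prop :=
  InPlace N picks U own A g ∧ rrRow N picks g < 2 ∧ N / 2 ≤ rrCol N picks g

instance {m : ℕ} (N : ℕ) (picks : List (Fin m)) (U : Finset (Fin m)) (own : Fin m → ℕ)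
    (A : Finset ℕ) (g : Fin m) : Decidable (IsDonor N picks U own A g) := by
  unfold IsDonor; infer_instance

/-- The exchange of the labels `i + k` and `mid + k - 1` for `1 ≤ k ≤ mid - 1 - i` (labels counted
from `0`); all other labels are fixed. -/
def swapLabel (mid i c : ℕ) : ℕ :=
  if i < c ∧ c < mid then mid + (c - i) - 1
  else if mid ≤ c ∧ c + i + 1 < 2 * mid then i + (c - mid) + 1
  else c

/-- Temporary rebundling for agent `i`: the top items of the parts `i + k` and `mid + k - 1` are
exchanged for `1 ≤ k ≤ mid - 1 - i`. A missing top item is replaced by nothing; a pair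
of parts one of which has been picked is left alone. -/
def rebundle {m : ℕ} (N i : ℕ) (picks : List (Fin m)) (U : Finset (Fin m)) (own : Fin m → ℕ)
    (A : Finset ℕ) : Fin m → ℕ := fun g =>
  if InPlace N picks U own A g ∧ rrRow N picks g = 0 ∧ swapLabel (N / 2) i (own g) ∈ A
  then swapLabel (N / 2) i (own g) else own g

namespace FairInstance

variable {n m : ℕ} (I : FairInstance n m)

/-- What the algorithm does when agent `a` arrives as number `i` (counted from `0`) of a stage with
`N` agents: the first component is the partition with the permanent changes made, the second is the
partition that is presented. If the part with label `i` is gone (an earlier agent took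
it), nothing is changed. -/
def prepare (N : ℕ) (picks : List (Fin m)) (U : Finset (Fin m)) (i : ℕ) (a : Fin n)
    (own : Fin m → ℕ) (A : Finset ℕ) : (Fin m → ℕ) × (Fin m → ℕ) :=
  if i ∉ A then (own, own)
  else if i + 1 = N / 2 then
    let M : Fin m → ℕ := fun g => if IsDonor N picks U own A g then i else own g
    (M, M)
  else
    match (List.finRange m).find? fun g => decide (IsDonor N picks U own A g ∧ 0 < I.val a g) with
    | some g => (Function.update own g i, Function.update own g i)
    | none => (own, rebundle N i picks U own A)

/-- The picking phase of a stage: the listed agents arrive one after the other, the first of them as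
number `i`. Returns the bundles taken, in order of arrival, and the items left over. The temporary
partition is discarded once agent `i` has taken part `i`; it is kept if the agent took
another part, whose content it may have changed. -/
def pickingPhase (choose : ChoiceRule n m) (N : ℕ) (picks : List (Fin m)) (U : Finset (Fin m)) :
    List (Fin n) → ℕ → (Fin m → ℕ) → Finset ℕ → List (Finset (Fin m)) × Finset (Fin m)
  | [], _, own, A => ([], U.filter fun g => own g ∈ A)
  | a :: rest, i, own, A =>
    let MM := I.prepare N picks U i a own A
    let q := choose a A (partOf U MM.2)
    let r := pickingPhase choose N picks U rest (i + 1) (if q = i then MM.1 else MM.2) (A.erase q)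
    (partOf U MM.2 q :: r.1, r.2)

/-- The algorithm for bounded proportional shares: `L` lists the agents in order of arrival, `U` is
the set of available items. Returns the bundles taken by the agents, in order of arrival. -/
def boundedProp (choose : ChoiceRule n m) (L : List (Fin n)) (U : Finset (Fin m)) :
    List (Finset (Fin m)) :=
  if L.length ≤ 1 then L.map fun _ => U
  else
    let N := L.length
    let picks := I.roundRobin L U
    let r := I.pickingPhase choose N picks U (L.take (N / 2)) 0 (rrCol N picks) (Finset.range N)
    r.1 ++ boundedProp choose (L.drop (N / 2)) r.2
termination_by L.length
decreasing_by simp only [List.length_drop]; omega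

/-- The bundle obtained by the agent `τ i` when the agents arrive in the order `τ` and choose by the
rule `choose` from the parts presented by the algorithm. -/
def received (choose : ChoiceRule n m) (τ : Equiv.Perm (Fin n)) (i : Fin n) : Finset (Fin m) :=
  (I.boundedProp choose (List.ofFn τ) Finset.univ).getD i ∅

end FairInstance

/-! ### A random access machine with unit costs

The machine has natural-number registers and real registers, and a memory of each kind that is addressed
indirectly through natural-number registers. The only arithmetic is addition and subtraction (no
multiplication, no rounding, no real constants besides `0` and `1`), so a computation of `t` steps
enlarges the numbers by at most `t` bits. -/

structure Mem where
  nreg : ℕ → ℕ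
  rreg : ℕ → ℝ
  nmem : ℕ → ℕ
  rmem : ℕ → ℝ

inductive Instr where
  | nconst (x k : ℕ)
  | nadd (x y z : ℕ)
  | nsub (x y z : ℕ)
  | nload (x y : ℕ)
  | nstore (x y : ℕ)
  | rzero (x : ℕ)
  | rone (x : ℕ)
  | radd (x y z : ℕ)
  | rsub (x y z : ℕ)
  | rload (x y : ℕ)
  | rstore (x y : ℕ)

def Instr.apply (s : Mem) : Instr → Mem
  | .nconst x k => { s with nreg := Function.update s.nreg x k }
  | .nadd x y z => { s with nreg := Function.update s.nreg x (s.nreg y + s.nreg z) }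
  | .nsub x y z => { s with nreg := Function.update s.nreg x (s.nreg y - s.nreg z) }
  | .nload x y => { s with nreg := Function.update s.nreg x (s.nmem (s.nreg y)) }
  | .nstore x y => { s with nmem := Function.update s.nmem (s.nreg x) (s.nreg y) }
  | .rzero x => { s with rreg := Function.update s.rreg x 0 }
  | .rone x => { s with rreg := Function.update s.rreg x 1 }
  | .radd x y z => { s with rreg := Function.update s.rreg x (s.rreg y + s.rreg z) }
  | .rsub x y z => { s with rreg := Function.update s.rreg x (s.rreg y - s.rreg z) }
  | .rload x y => { s with rreg := Function.update s.rreg x (s.rmem (s.nreg y)) }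
  | .rstore x y => { s with rmem := Function.update s.rmem (s.nreg x) (s.rreg y) }

/-- Comparison of two registers. -/
inductive RegTest where
  | nle (x y : ℕ)
  | rle (x y : ℕ)

def RegTest.Holds (s : Mem) : RegTest → Prop
  | .nle x y => s.nreg x ≤ s.nreg y
  | .rle x y => s.rreg x ≤ s.rreg y

inductive Program where
  | instr (c : Instr)
  | seq (p q : Program)
  | cond (b : RegTest) (p q : Program)
  | loop (b : RegTest) (p : Program)

/-- `Exec p s s' t`: started in memory `s`, the program `p` halts in memory `s'` after exactly `t`
steps. An instruction is one step, and so is each evaluation of a test; `loop b p` repeats `p` as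
long as `b` holds. -/
inductive Exec : Program → Mem → Mem → ℕ → Prop
  | instr (c : Instr) (s : Mem) : Exec (.instr c) s (c.apply s) 1
  | seq {p q : Program} {s s' s'' : Mem} {t t' : ℕ} :
      Exec p s s' t → Exec q s' s'' t' → Exec (.seq p q) s s'' (t + t')
  | cond_true {b : RegTest} {p q : Program} {s s' : Mem} {t : ℕ} :
      b.Holds s → Exec p s s' t → Exec (.cond b p q) s s' (t + 1)
  | cond_false {b : RegTest} {p q : Program} {s s' : Mem} {t : ℕ} :
      ¬ b.Holds s → Exec q s s' t → Exec (.cond b p q) s s' (t + 1)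
  | loop_true {b : RegTest} {p : Program} {s s' s'' : Mem} {t t' : ℕ} :
      b.Holds s → Exec p s s' t → Exec (.loop b p) s' s'' t' →
      Exec (.loop b p) s s'' (t + t' + 1)
  | loop_false {b : RegTest} {p : Program} {s : Mem} :
      ¬ b.Holds s → Exec (.loop b p) s s 1

/-- The input: `n` and `m` in the first two natural-number registers, the valuation matrix row by row
(the value of agent `a` for item `g` at address `a * m + g`) in the real memory, and `0` elsewhere. -/
def FairInstance.input {n m : ℕ} (I : FairInstance n m) : Mem where
  nreg := fun x => if x = 0 then n else if x = 1 then m else 0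
  rreg := fun _ => 0
  nmem := fun _ => 0
  rmem := fun k => if h : k < n * m then I.val (Fin.divNat ⟨k, h⟩) (Fin.modNat ⟨k, h⟩) else 0

/-- On the instance `I` the program halts within `T` steps, with the order `τ` written in the first `n`
cells of the natural-number memory. -/
def Program.ComputesOrder {n m : ℕ} (p : Program) (I : FairInstance n m) (τ : Equiv.Perm (Fin n))
    (T : ℕ) : Prop :=
  ∃ (s : Mem) (t : ℕ), Exec p I.input s t ∧ t ≤ T ∧ ∀ i : Fin n, s.nmem i = (τ i : ℕ)

end

/-! The agents arrive in the order of decreasing total value. An agent values her Round-Robin column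
at least at her proportional share minus `1`, so the claim is trivial for an agent of small share,
and every agent who arrives before one of large share has a large share too.

In a stage an agent of large share strictly prefers the part with her own label, which contains her
column. Row by row, the items of any later column are worth at most as much to her as those of her
own column. Moreover, either she has been given a donor item that she values, or each of the other
parts lacks, up to items worthless to her, a whole row in which her own column has an item that she
values. Hence each part is taken by the agent whose label it bears, and the items left over are the
columns of the second half without their first two rows. Round-Robin is consistent, so these rows
are what the agents of the second half obtain in a new run on the leftover items: each stage costs
an agent at most the two items she picked first, that is, at most `2`.

The order is computed by writing the row sums into the memory and then storing each agent in the
cell whose address is the rank of her row sum. -/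

namespace FairInstance

variable {n m : ℕ} {I : FairInstance n m} {a : Fin n} {L : List (Fin n)} {g x : Fin m}
  {S T U V : Finset (Fin m)}

/-! ### Values of sets of items -/

lemma value_mono (a : Fin n) (h : S ⊆ T) : I.value a S ≤ I.value a T :=
  Finset.sum_le_sum_of_subset_of_nonneg h fun _ _ _ => I.val_nonneg _ _

lemma value_nonneg (a : Fin n) (S : Finset (Fin m)) : 0 ≤ I.value a S :=
  Finset.sum_nonneg fun _ _ => I.val_nonneg _ _

lemma value_le_card (a : Fin n) (S : Finset (Fin m)) : I.value a S ≤ S.card := by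
  simpa [value] using Finset.sum_le_card_nsmul S (I.val a) 1 fun g _ => I.val_le_one a g

lemma value_lt_value_of_mem_of_notMem (h : S ⊆ T) (hgT : g ∈ T) (hgS : g ∉ S)
    (hg : 0 < I.val a g) : I.value a S < I.value a T :=
  Finset.sum_lt_sum_of_subset h hgT hgS hg fun _ _ _ => I.val_nonneg _ _

lemma value_filter_val_pos (a : Fin n) (S : Finset (Fin m)) :
    I.value a (S.filter fun g => 0 < I.val a g) = I.value a S :=
  Finset.sum_filter_of_ne fun g _ hg => (I.val_nonneg a g).lt_of_ne' hg

/-! ### Round-Robin -/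

lemma topItem_eq_some_spec (h : I.topItem a U = some g) :
    g ∈ U ∧ ∀ x ∈ U, I.val a x ≤ I.val a g := by
  simpa using List.find?_some h

lemma exists_topItem_eq_some (a : Fin n) (hU : U.Nonempty) : ∃ g, I.topItem a U = some g := by
  obtain ⟨g, hg, hmax⟩ := U.exists_max_image (I.val a) hU
  rw [← Option.isSome_iff_exists, topItem, List.find?_isSome]
  exact ⟨g, List.mem_finRange g, by simpa using ⟨hg, hmax⟩⟩

lemma topItem_eq_some_of_subset (hVU : V ⊆ U) (hg : g ∈ V) (h : I.topItem a U = some g) :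
    I.topItem a V = some g := by
  have hmax := (topItem_eq_some_spec h).2
  unfold topItem at h ⊢
  rw [List.find?_eq_some_iff_append] at h ⊢
  obtain ⟨-, l₁, l₂, hsplit, hbefore⟩ := h
  refine ⟨by simpa using ⟨hg, fun x hx => hmax x (hVU hx)⟩, l₁, l₂, hsplit, fun x hx => ?_⟩
  have hx_not_top := hbefore x hx
  simp only [Bool.not_eq_true', decide_eq_false_iff_not] at hx_not_top ⊢
  exact fun ⟨hxV, hx_max⟩ =>
    hx_not_top ⟨hVU hxV, fun y hy => (hmax y hy).trans (hx_max g hg)⟩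

/-- `I.IsRoundRobin L U q`: the list `q` of pairs (agent, item) records a complete run of
Round-Robin on the items `U` with picking sequence `L`. Unlike the list `I.roundRobin L U` of the
items alone, it can be restricted to the picks of some of the agents. -/
inductive IsRoundRobin (I : FairInstance n m) :
    List (Fin n) → Finset (Fin m) → List (Fin n × Fin m) → Prop
  | nil (L : List (Fin n)) : IsRoundRobin I L ∅ []
  | cons {a : Fin n} {L : List (Fin n)} {U : Finset (Fin m)} {g : Fin m}
      {q : List (Fin n × Fin m)} (htop : I.topItem a U = some g)
      (hq : IsRoundRobin I (L ++ [a]) (U.erase g) q) : IsRoundRobin I (a :: L) U ((a, g) :: q)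

lemma exists_isRoundRobin (hL : L ≠ []) (U : Finset (Fin m)) : ∃ q, I.IsRoundRobin L U q := by
  induction U using Finset.strongInduction generalizing L with
  | H U ih =>
    obtain rfl | hU := U.eq_empty_or_nonempty
    · exact ⟨[], .nil L⟩
    · obtain ⟨a, L, rfl⟩ := List.exists_cons_of_ne_nil hL
      obtain ⟨g, hg⟩ := exists_topItem_eq_some (I := I) a hU
      obtain ⟨q, hq⟩ := ih (U.erase g) (Finset.erase_ssubset (topItem_eq_some_spec hg).1)
        (L := L ++ [a]) (by simp)
      exact ⟨(a, g) :: q, .cons hg hq⟩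

namespace IsRoundRobin

variable {q : List (Fin n × Fin m)}

lemma mem_map_snd_iff (h : I.IsRoundRobin L U q) : x ∈ q.map Prod.snd ↔ x ∈ U := by
  induction h with
  | nil => simp
  | @cons _ _ _ g _ htop _ ih =>
    have hg := (topItem_eq_some_spec htop).1
    rw [List.map_cons, List.mem_cons, ih, Finset.mem_erase]
    by_cases hx : x = g <;> simp [hx, hg]

lemma nodup_map_snd (h : I.IsRoundRobin L U q) : (q.map Prod.snd).Nodup := by
  induction h with
  | nil => simp
  | cons _ hq ih => exact List.nodup_cons.2 ⟨by simp [hq.mem_map_snd_iff], ih⟩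

lemma roundRobin_eq (h : I.IsRoundRobin L U q) : I.roundRobin L U = q.map Prod.snd := by
  unfold roundRobin
  induction h with
  | nil => rfl
  | cons htop _ ih =>
    rw [← Finset.card_erase_add_one (topItem_eq_some_spec htop).1, roundRobinAux]
    simp only [htop, List.map_cons, ih]

lemma exists_drop (h : I.IsRoundRobin L U q) (t : ℕ) :
    ∃ V, I.IsRoundRobin (L.rotate t) V (q.drop t) := by
  induction h generalizing t with
  | nil L => exact ⟨∅, by simpa using nil _⟩
  | cons htop hq ih =>
    cases t with
    | zero => exact ⟨_, by simpa using cons htop hq⟩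
    | succ t => simpa using ih t

/-- Round-Robin is consistent: once some agents have left with what they picked, a new run gives
the same items to the others. -/
lemma exists_filter (h : I.IsRoundRobin L U q) (S : Fin n → Bool) :
    ∃ V ⊆ U, I.IsRoundRobin (L.filter S) V (q.filter fun x => S x.1) := by
  induction h with
  | nil => exact ⟨∅, subset_rfl, nil _⟩
  | @cons a L U g q htop _ ih =>
    obtain ⟨V, hVU, hV⟩ := ih
    by_cases hS : S a
    · have hgV : g ∉ V := fun hg => by simpa using hVU hg
      have hsub : insert g V ⊆ U :=
        Finset.insert_subset (topItem_eq_some_spec htop).1 (hVU.trans (U.erase_subset g))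
      refine ⟨insert g V, hsub, ?_⟩
      rw [List.filter_cons_of_pos hS, List.filter_cons_of_pos (by exact hS)]
      refine cons (topItem_eq_some_of_subset hsub (by simp) htop) ?_
      rw [Finset.erase_insert hgV]
      simpa [hS] using hV
    · refine ⟨V, hVU.trans (U.erase_subset g), ?_⟩
      rw [List.filter_cons_of_neg hS, List.filter_cons_of_neg (by exact hS)]
      simpa [hS] using hV

lemma fst_getElem (h : I.IsRoundRobin L U q) {t : ℕ} (ht : t < q.length)
    (hlt : t % L.length < L.length) : q[t].1 = L[t % L.length] := by
  obtain ⟨V, hV⟩ := h.exists_drop t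
  rw [List.drop_eq_getElem_cons ht] at hV
  have hhead : (L.rotate t).head? = some q[t].1 := by
    generalize L.rotate t = L', q[t] = y, q.drop (t + 1) = q' at hV
    cases hV
    rfl
  rw [← List.rotate_mod, List.head?_rotate hlt, List.getElem?_eq_getElem hlt] at hhead
  exact (Option.some.inj hhead).symm

lemma val_getElem_le (h : I.IsRoundRobin L U q) {t t' : ℕ} (htt : t ≤ t') (ht' : t' < q.length) :
    I.val q[t].1 q[t'].2 ≤ I.val q[t].1 q[t].2 := by
  obtain ⟨V, hV⟩ := h.exists_drop t
  have hmem : q[t'].2 ∈ V := by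
    rw [← hV.mem_map_snd_iff, List.map_drop, List.mem_drop_iff_getElem]
    exact ⟨t' - t, by simp only [List.length_map]; omega, by simp [Nat.add_sub_cancel' htt]⟩
  rw [List.drop_eq_getElem_cons (by omega)] at hV
  generalize L.rotate t = L', q[t] = y, q.drop (t + 1) = q' at hV ⊢
  cases hV with
  | cons htop _ => exact (topItem_eq_some_spec htop).2 _ hmem

lemma mem_drop_iff (h : I.IsRoundRobin L U q) (hL : L.Nodup) {c : ℕ} (hc : c < L.length)
    (s : ℕ) :
    (L[c], g) ∈ q.drop s ↔ g ∈ U ∧ rrCol L.length (I.roundRobin L U) g = c ∧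
      s ≤ (I.roundRobin L U).idxOf g := by
  have hmod (t : ℕ) : t % L.length < L.length := Nat.mod_lt _ (by omega)
  rw [h.roundRobin_eq, ← h.mem_map_snd_iff]
  constructor
  · intro hx
    obtain ⟨t, ht, hqt⟩ := List.mem_drop_iff_getElem.1 hx
    have ht' : s + t < (q.map Prod.snd).length := by simpa using by omega
    have hg : (q.map Prod.snd)[s + t] = g := by simp [hqt]
    have hidx : (q.map Prod.snd).idxOf g = s + t := hg ▸ h.nodup_map_snd.idxOf_getElem _ _
    refine ⟨hg ▸ List.getElem_mem _, ?_, by omega⟩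
    have hagent := h.fst_getElem (t := s + t) (by omega) (hmod _)
    rw [hqt, hL.getElem_inj_iff] at hagent
    rw [rrCol, hidx, hagent]
  · rintro ⟨hg, hcol, hs⟩
    have ht := List.idxOf_lt_length_of_mem hg
    have ht' : (q.map Prod.snd).idxOf g < q.length := by simpa using ht
    refine List.mem_drop_iff_getElem.2 ⟨(q.map Prod.snd).idxOf g - s, by omega, ?_⟩
    simp only [Nat.add_sub_cancel' hs]
    refine Prod.ext ?_ ?_
    · rw [h.fst_getElem ht' (hmod _)]
      congr 1
    · rw [← List.getElem_map Prod.snd (h := ht)]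
      exact List.getElem_idxOf ht

end IsRoundRobin

lemma mem_roundRobin_iff (hL : L ≠ []) : g ∈ I.roundRobin L U ↔ g ∈ U := by
  obtain ⟨q, hq⟩ := exists_isRoundRobin (I := I) hL U
  rw [hq.roundRobin_eq, hq.mem_map_snd_iff]

end FairInstance

/-! ### The Round-Robin matrix -/

lemma rrRow_mul_add_rrCol {m : ℕ} (N : ℕ) (picks : List (Fin m)) (g : Fin m) :
    rrRow N picks g * N + rrCol N picks g = picks.idxOf g :=
  Nat.div_add_mod' _ _

lemma eq_of_rrRow_eq_of_rrCol_eq {m N : ℕ} {picks : List (Fin m)} {g h : Fin m}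
    (hg : g ∈ picks) (hrow : rrRow N picks g = rrRow N picks h)
    (hcol : rrCol N picks g = rrCol N picks h) : g = h :=
  (List.idxOf_inj hg).1 <| by
    rw [← rrRow_mul_add_rrCol N picks g, ← rrRow_mul_add_rrCol N picks h, hrow, hcol]

lemma injOn_rrRow_partOf {m N : ℕ} {picks : List (Fin m)} {U : Finset (Fin m)}
    (hU : ∀ g ∈ U, g ∈ picks) (c : ℕ) :
    Set.InjOn (rrRow N picks) (partOf U (rrCol N picks) c) := by
  intro g hg h hh hrow
  simp only [partOf, Finset.coe_filter, Set.mem_ofPred_eq] at hg hh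
  exact eq_of_rrRow_eq_of_rrCol_eq (hU g hg.1) hrow (hg.2.trans hh.2.symm)

namespace FairInstance

section Matrix

variable {n m N i r : ℕ} {I : FairInstance n m} {a : Fin n} {picks : List (Fin m)}
  {S U : Finset (Fin m)}

lemma value_column_le_add_value_lower_rows (hU : ∀ g ∈ U, g ∈ picks) (a : Fin n) (c r : ℕ) :
    I.value a (partOf U (rrCol N picks) c) ≤
      r + I.value a ((partOf U (rrCol N picks) c).filter fun g => r ≤ rrRow N picks g) := by
  set upper := (partOf U (rrCol N picks) c).filter fun g => ¬r ≤ rrRow N picks g with hupper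
  have hcard : upper.card ≤ (Finset.range r).card :=
    Finset.card_le_card_of_injOn (rrRow N picks)
      (fun g hg => by simpa [hupper] using (Finset.mem_filter.1 hg).2)
      ((injOn_rrRow_partOf hU c).mono (Finset.coe_subset.2 (Finset.filter_subset _ _)))
  have hvalue : I.value a upper ≤ r :=
    (value_le_card a upper).trans (by exact_mod_cast hcard.trans_eq (Finset.card_range r))
  calc I.value a (partOf U (rrCol N picks) c)
      = I.value a ((partOf U (rrCol N picks) c).filter fun g => r ≤ rrRow N picks g) +
          I.value a upper := (Finset.sum_filter_add_sum_filter_not _ _ _).symm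
    _ ≤ _ := by linarith

/-- Column `i` of the matrix dominates for agent `a`: every item picked in or after the turn of
column `i` in row `r` is worth at most as much to `a` as the item in that row and column. This is
what Round-Robin ensures for the agent who picks column `i`. -/
def ColumnDominates (I : FairInstance n m) (a : Fin n) (N i : ℕ) (picks : List (Fin m))
    (U : Finset (Fin m)) : Prop :=
  ∀ g ∈ U, ∀ r, r * N + i ≤ picks.idxOf g →
    ∃ h ∈ U, rrRow N picks h = r ∧ rrCol N picks h = i ∧ I.val a g ≤ I.val a h

namespace ColumnDominates

lemma value_le_value_rows (hdom : I.ColumnDominates a N i picks U) (hS : S ⊆ U) {f : Fin m → ℕ}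
    (hinj : Set.InjOn f S) (hf : ∀ g ∈ S, f g * N + i ≤ picks.idxOf g) :
    I.value a S ≤
      I.value a ((partOf U (rrCol N picks) i).filter fun h => rrRow N picks h ∈ S.image f) := by
  have hcell (g : Fin m) : ∃ h, g ∈ S →
      h ∈ U ∧ rrRow N picks h = f g ∧ rrCol N picks h = i ∧ I.val a g ≤ I.val a h := by
    by_cases hg : g ∈ S
    · obtain ⟨h, hh⟩ := hdom g (hS hg) (f g) (hf g hg)
      exact ⟨h, fun _ => hh⟩
    · exact ⟨g, fun h => absurd h hg⟩
  choose cell hcell using hcell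
  have hcell_inj : Set.InjOn cell S := fun g hg h hh hgh => hinj hg hh <| by
    rw [← (hcell g hg).2.1, ← (hcell h hh).2.1, hgh]
  calc I.value a S
      ≤ ∑ g ∈ S, I.val a (cell g) := Finset.sum_le_sum fun g hg => (hcell g hg).2.2.2
    _ = I.value a (S.image cell) := (Finset.sum_image hcell_inj).symm
    _ ≤ _ := value_mono a fun h hh => by
        obtain ⟨g, hg, rfl⟩ := Finset.mem_image.1 hh
        obtain ⟨hmem, hrow, hcol, -⟩ := hcell g hg
        simp only [partOf, Finset.mem_filter]
        exact ⟨⟨hmem, hcol⟩, hrow ▸ Finset.mem_image_of_mem f hg⟩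

lemma value_le_value_column (hdom : I.ColumnDominates a N i picks U) (hS : S ⊆ U)
    {f : Fin m → ℕ} (hinj : Set.InjOn f S) (hf : ∀ g ∈ S, f g * N + i ≤ picks.idxOf g) :
    I.value a S ≤ I.value a (partOf U (rrCol N picks) i) :=
  (hdom.value_le_value_rows hS hinj hf).trans (value_mono a (Finset.filter_subset _ _))

lemma value_column_le (hdom : I.ColumnDominates a N i picks U) (hU : ∀ g ∈ U, g ∈ picks) {c : ℕ}
    (hic : i ≤ c) :
    I.value a (partOf U (rrCol N picks) c) ≤ I.value a (partOf U (rrCol N picks) i) :=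
  hdom.value_le_value_column (Finset.filter_subset _ _) (injOn_rrRow_partOf hU c) fun g hg => by
    rw [← rrRow_mul_add_rrCol N picks g, (Finset.mem_filter.1 hg).2]
    omega

lemma value_column_le_add_one (hdom : I.ColumnDominates a N i picks U)
    (hU : ∀ g ∈ U, g ∈ picks) (hi : i ≤ N) (c : ℕ) :
    I.value a (partOf U (rrCol N picks) c) ≤ I.value a (partOf U (rrCol N picks) i) + 1 := by
  have hlower : I.value a ((partOf U (rrCol N picks) c).filter fun g => 1 ≤ rrRow N picks g) ≤
      I.value a (partOf U (rrCol N picks) i) := by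
    -- the turn of column `i` in any row comes before the whole next row
    refine hdom.value_le_value_column (f := fun g => rrRow N picks g - 1)
      ((Finset.filter_subset _ _).trans (Finset.filter_subset _ _)) ?_ ?_
    · intro g hg h hh hgh
      simp only [Finset.coe_filter, Set.mem_ofPred_eq] at hg hh hgh
      exact injOn_rrRow_partOf hU c hg.1 hh.1 (by omega)
    · intro g hg
      obtain ⟨r, hr⟩ := Nat.exists_eq_add_of_le' (Finset.mem_filter.1 hg).2
      rw [← rrRow_mul_add_rrCol N picks g, hr, Nat.add_sub_cancel, Nat.add_mul]
      omega
  have := value_column_le_add_value_lower_rows (I := I) (N := N) hU a c 1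
  push_cast at this
  linarith

lemma exists_val_pos (hdom : I.ColumnDominates a N i picks U) (hU : ∀ g ∈ U, g ∈ picks)
    (hr : r < I.value a (partOf U (rrCol N picks) i)) :
    ∃ g ∈ U, rrRow N picks g = r ∧ rrCol N picks g = i ∧ 0 < I.val a g := by
  have hlower := value_column_le_add_value_lower_rows (I := I) (N := N) hU a i r
  obtain ⟨g, hg, hpos⟩ := Finset.exists_lt_of_sum_lt (f := fun _ => (0 : ℝ)) (g := I.val a)
    (s := (partOf U (rrCol N picks) i).filter fun g => r ≤ rrRow N picks g)
    (by rw [Finset.sum_const_zero]; change 0 < I.value a _; linarith)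
  simp only [partOf, Finset.mem_filter] at hg
  obtain ⟨⟨hgU, hcol⟩, hrow⟩ := hg
  obtain ⟨h, hhU, hhr, hhc, hle⟩ := hdom g hgU r (by
    rw [← rrRow_mul_add_rrCol N picks g, hcol]
    gcongr)
  exact ⟨h, hhU, hhr, hhc, hpos.trans_le hle⟩

/-- The column has an item of positive value in the row that `S` misses. -/
lemma value_lt_of_rrRow_ne (hdom : I.ColumnDominates a N i picks U)
    (hU : ∀ g ∈ U, g ∈ picks) (hr : r < I.value a (partOf U (rrCol N picks) i)) (hS : S ⊆ U)
    (hinj : Set.InjOn (rrRow N picks) S) (hcol : ∀ g ∈ S, i ≤ rrCol N picks g)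
    (hrow : ∀ g ∈ S, rrRow N picks g ≠ r) :
    I.value a S < I.value a (partOf U (rrCol N picks) i) := by
  obtain ⟨h, hhU, hhr, hhc, hpos⟩ := hdom.exists_val_pos hU hr
  refine (hdom.value_le_value_rows hS hinj fun g hg => ?_).trans_lt
    (value_lt_value_of_mem_of_notMem (Finset.filter_subset _ _)
      (Finset.mem_filter.2 ⟨hhU, hhc⟩) (fun hh => ?_) hpos)
  · rw [← rrRow_mul_add_rrCol N picks g]
    have := hcol g hg
    omega
  · obtain ⟨g, hg, hgr⟩ := Finset.mem_image.1 (Finset.mem_filter.1 hh).2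
    exact hrow g hg (hgr.trans hhr)

end ColumnDominates

end Matrix

section Column

variable {n m : ℕ} {I : FairInstance n m} {L : List (Fin n)} {U : Finset (Fin m)} {i : ℕ}

lemma columnDominates_roundRobin (U : Finset (Fin m)) (hi : i < L.length) :
    I.ColumnDominates L[i] L.length i (I.roundRobin L U) U := by
  obtain ⟨q, hq⟩ := exists_isRoundRobin (I := I) (L := L) (List.ne_nil_of_length_pos (by omega)) U
  rw [hq.roundRobin_eq]
  intro g hg r hr
  have hidx := List.idxOf_lt_length_of_mem (hq.mem_map_snd_iff.2 hg)
  have hidx' : (q.map Prod.snd).idxOf g < q.length := by simpa using hidx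
  have hturn : r * L.length + i < (q.map Prod.snd).length := by omega
  have hturn_idx := hq.nodup_map_snd.idxOf_getElem _ hturn
  have hmod : (r * L.length + i) % L.length = i := Nat.mul_add_mod_of_lt hi
  refine ⟨(q.map Prod.snd)[r * L.length + i], hq.mem_map_snd_iff.1 (List.getElem_mem _), ?_, ?_, ?_⟩
  · rw [rrRow, hturn_idx, mul_comm, Nat.mul_add_div (by omega), Nat.div_eq_of_lt hi, add_zero]
  · rw [rrCol, hturn_idx, hmod]
  · have hle := hq.val_getElem_le hr hidx'
    have hagent := hq.fst_getElem (t := r * L.length + i) (by omega) (by omega)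
    have hg_eq : q[(q.map Prod.snd).idxOf g].2 = g := by
      rw [← List.getElem_map Prod.snd (h := hidx), List.getElem_idxOf hidx]
    simp only [hmod] at hagent
    rwa [hagent, hg_eq, ← List.getElem_map Prod.snd (h := hturn)] at hle

/-- Column `c` of the Round-Robin matrix: the items that Round-Robin on `U` with picking sequence
`L` gives to the agent `L[c]`. -/
noncomputable def column (I : FairInstance n m) (L : List (Fin n)) (U : Finset (Fin m))
    (c : ℕ) : Finset (Fin m) :=
  partOf U (rrCol L.length (I.roundRobin L U)) c

/-- The items in the rows `r, r + 1, …` and the columns `d, d + 1, …` of the Round-Robin matrix.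
With `r = 2` and `d` half the number of agents, these are left over by a stage in which every
agent takes her own part. -/
noncomputable def lowerRight (I : FairInstance n m) (L : List (Fin n)) (U : Finset (Fin m))
    (r d : ℕ) : Finset (Fin m) :=
  U.filter fun g => r ≤ rrRow L.length (I.roundRobin L U) g ∧
    d ≤ rrCol L.length (I.roundRobin L U) g

lemma value_le_length_mul (U : Finset (Fin m)) (hi : i < L.length) :
    I.value L[i] U ≤ L.length * (I.value L[i] (I.column L U i) + 1) := by
  have hcolumn (c : ℕ) : I.value L[i] (I.column L U c) ≤ I.value L[i] (I.column L U i) + 1 :=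
    (columnDominates_roundRobin U hi).value_column_le_add_one
      (fun g => (mem_roundRobin_iff (L := L) (List.ne_nil_of_length_pos (by omega))).2) hi.le c
  calc I.value L[i] U = ∑ c ∈ Finset.range L.length, I.value L[i] (I.column L U c) :=
        (Finset.sum_fiberwise_of_maps_to (fun g _ => Finset.mem_range.2
          (Nat.mod_lt ((I.roundRobin L U).idxOf g) (by omega))) _).symm
    _ ≤ L.length * (I.value L[i] (I.column L U i) + 1) := by
        simpa [mul_add] using
          Finset.sum_le_card_nsmul (Finset.range L.length) _ _ fun c _ => hcolumn c

lemma IsRoundRobin.mem_drop_mul_length_iff {q : List (Fin n × Fin m)} {c : ℕ} {g : Fin m}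
    (h : I.IsRoundRobin L U q) (hL : L.Nodup) (hc : c < L.length) (r : ℕ) :
    (L[c], g) ∈ q.drop (r * L.length) ↔
      g ∈ I.column L U c ∧ r ≤ rrRow L.length (I.roundRobin L U) g := by
  rw [h.mem_drop_iff hL hc, rrRow, Nat.le_div_iff_mul_le (by omega), column, partOf,
    Finset.mem_filter, and_assoc]

/-- If the first `d` agents leave with everything outside `lowerRight`, the remaining picks are a
Round-Robin run of the other agents. -/
lemma IsRoundRobin.filter_drop {q : List (Fin n × Fin m)} (h : I.IsRoundRobin L U q)
    (hL : L.Nodup) (r : ℕ) {d : ℕ} (hd : d < L.length) :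
    I.IsRoundRobin (L.drop d) (I.lowerRight L U r d)
      ((q.drop (r * L.length)).filter fun x => x.1 ∈ L.drop d) := by
  have hfilter : L.filter (fun a => decide (a ∈ L.drop d)) = L.drop d := by
    conv_lhs => rw [← List.take_append_drop d L]
    rw [List.filter_append, List.filter_eq_nil_iff.2, List.filter_eq_self.2, List.nil_append]
    · simp
    · intro a ha
      simpa using List.disjoint_take_drop hL le_rfl ha
  obtain ⟨W, hW⟩ := h.exists_drop (r * L.length)
  obtain ⟨V, -, hV⟩ := hW.exists_filter fun a => a ∈ L.drop d
  rw [mul_comm r, List.rotate_length_mul, hfilter, mul_comm] at hV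
  convert hV using 1
  ext g
  rw [← hV.mem_map_snd_iff, List.mem_map, lowerRight, Finset.mem_filter]
  constructor
  · rintro ⟨hg, hrow, hcol⟩
    have hlt : rrCol L.length (I.roundRobin L U) g < L.length := Nat.mod_lt _ (by omega)
    refine ⟨(L[rrCol L.length (I.roundRobin L U) g], g), List.mem_filter.2 ⟨?_, ?_⟩, rfl⟩
    · exact (h.mem_drop_mul_length_iff hL hlt r).2 ⟨Finset.mem_filter.2 ⟨hg, rfl⟩, hrow⟩
    · exact decide_eq_true (List.mem_drop_iff_getElem.2
        ⟨rrCol L.length (I.roundRobin L U) g - d, by omega, by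
          simp only [Nat.add_sub_cancel' hcol]⟩)
  · rintro ⟨⟨a, g⟩, hx, rfl⟩
    obtain ⟨hx, ha⟩ := List.mem_filter.1 hx
    obtain ⟨e, he, rfl⟩ := List.mem_drop_iff_getElem.1 (of_decide_eq_true ha)
    obtain ⟨hg, hrow⟩ := (h.mem_drop_mul_length_iff hL _ r).1 hx
    obtain ⟨hgU, hcol⟩ := Finset.mem_filter.1 hg
    exact ⟨hgU, hrow, by simp only at hcol ⊢; omega⟩

lemma column_drop_lowerRight (hL : L.Nodup) (U : Finset (Fin m)) (r : ℕ) {d c : ℕ}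
    (hc : d + c < L.length) :
    I.column (L.drop d) (I.lowerRight L U r d) c =
      (I.column L U (d + c)).filter fun g => r ≤ rrRow L.length (I.roundRobin L U) g := by
  obtain ⟨q, hq⟩ := exists_isRoundRobin (I := I) (L := L) (List.ne_nil_of_length_pos (by omega)) U
  have hc' : c < (L.drop d).length := by rw [List.length_drop]; omega
  have hget : (L.drop d)[c] = L[d + c] := List.getElem_drop
  ext g
  have hmem := (hq.filter_drop hL r (by omega)).mem_drop_mul_length_iff
    (hL.sublist (List.drop_sublist d L)) hc' (g := g) 0
  rw [zero_mul, List.drop_zero, List.mem_filter, hget, hq.mem_drop_mul_length_iff hL hc] at hmem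
  have hagent : L[d + c] ∈ L.drop d := hget ▸ List.getElem_mem hc'
  simpa [hagent] using hmem.symm

lemma value_column_le_add_value_column_drop (hL : L.Nodup) (U : Finset (Fin m)) (r : ℕ) {d c : ℕ}
    (hc : d + c < L.length) (a : Fin n) :
    I.value a (I.column L U (d + c)) ≤
      r + I.value a (I.column (L.drop d) (I.lowerRight L U r d) c) := by
  rw [column_drop_lowerRight hL U r hc]
  exact value_column_le_add_value_lower_rows
    (fun g => (mem_roundRobin_iff (L := L) (List.ne_nil_of_length_pos (by omega))).2) a _ r

end Column

end FairInstance

/-! ### One stage -/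

/-- The situation in a stage when each of the agents `0, …, i - 1` has taken the part with her own
number: only donor items have moved, all of them to the parts of these agents, and once the first
half of the agents is through, no donor item is left in place. -/
structure OnlyDonorsMoved {m : ℕ} (N : ℕ) (picks : List (Fin m)) (U : Finset (Fin m)) (i : ℕ)
    (own : Fin m → ℕ) : Prop where
  own_eq_or : ∀ g ∈ U, own g = rrCol N picks g ∨
    (rrRow N picks g < 2 ∧ N / 2 ≤ rrCol N picks g ∧ own g < i)
  own_lt_half : i = N / 2 → ∀ g ∈ U, rrRow N picks g < 2 → N / 2 ≤ rrCol N picks g → own g < N / 2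

/-- The partition obtained from `own` by moving all donor items to part `i`. -/
def collectDonors {m : ℕ} (N : ℕ) (picks : List (Fin m)) (U : Finset (Fin m)) (own : Fin m → ℕ)
    (A : Finset ℕ) (i : ℕ) : Fin m → ℕ :=
  fun g => if IsDonor N picks U own A g then i else own g

section Stage

variable {m N i q : ℕ} {picks : List (Fin m)} {U : Finset (Fin m)} {own M : Fin m → ℕ} {g : Fin m}
  {A : Finset ℕ}

lemma collectDonors_eq_or (g : Fin m) :
    collectDonors N picks U own A i g = own g ∨
      collectDonors N picks U own A i g = i :=
  (ite_eq_or_eq _ _ _).symm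

lemma update_eq_or (g₀ g : Fin m) :
    Function.update own g₀ i g = own g ∨ Function.update own g₀ i g = i := by
  rw [Function.update_apply]
  exact (ite_eq_or_eq _ _ _).symm

lemma rebundle_eq_of_own_eq (hg : own g = i) : rebundle N i picks U own A g = i := by
  simp only [rebundle, swapLabel, hg]
  split_ifs <;> omega

namespace OnlyDonorsMoved

lemma zero (hN : 2 ≤ N) : OnlyDonorsMoved N picks U 0 (rrCol N picks) :=
  ⟨fun _ _ => Or.inl rfl, fun h => by omega⟩

lemma rrCol_eq (h : OnlyDonorsMoved N picks U i own) (hg : g ∈ U) (hi : i ≤ own g) :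
    rrCol N picks g = own g := by
  have := h.own_eq_or g hg
  omega

lemma own_eq (h : OnlyDonorsMoved N picks U i own) (hg : g ∈ U) (hcol : rrCol N picks g < N / 2) :
    own g = rrCol N picks g := by
  have := h.own_eq_or g hg
  omega

lemma isDonor_iff (h : OnlyDonorsMoved N picks U i own) (hi : i < N / 2) (hg : g ∈ U) :
    IsDonor N picks U own (Finset.Ico i N) g ↔
      rrRow N picks g < 2 ∧ N / 2 ≤ rrCol N picks g ∧ i ≤ own g := by
  have hlt : rrCol N picks g < N := Nat.mod_lt _ (by omega)
  have := h.own_eq_or g hg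
  simp only [IsDonor, InPlace, hg, true_and, Finset.mem_Ico]
  omega

lemma column_subset_partOf (h : OnlyDonorsMoved N picks U i own) (hi : i < N / 2)
    (hM : ∀ g, M g = own g ∨ M g = i) : partOf U (rrCol N picks) i ⊆ partOf U M i := by
  intro g hg
  obtain ⟨hgU, hcol⟩ := Finset.mem_filter.1 hg
  have hown := h.own_eq hgU (by omega)
  exact Finset.mem_filter.2 ⟨hgU, by have := hM g; omega⟩

lemma partOf_subset_column (h : OnlyDonorsMoved N picks U i own) (hM : ∀ g, M g = own g ∨ M g = i)
    (hq : i < q) : partOf U M q ⊆ partOf U (rrCol N picks) q := by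
  intro g hg
  obtain ⟨hgU, hMg⟩ := Finset.mem_filter.1 hg
  have hown : own g = q := by have := hM g; omega
  exact Finset.mem_filter.2 ⟨hgU, (h.rrCol_eq hgU (by omega)).trans hown⟩

lemma two_le_rrRow_of_mem_partOf_collectDonors (h : OnlyDonorsMoved N picks U i own)
    (hi : i < N / 2) (hq : N / 2 ≤ q)
    (hg : g ∈ partOf U (collectDonors N picks U own (Finset.Ico i N) i) q) :
    2 ≤ rrRow N picks g := by
  obtain ⟨hgU, hgq⟩ := Finset.mem_filter.1 hg
  have hcol := h.rrCol_eq hgU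
  simp only [collectDonors, h.isDonor_iff hi hgU] at hgq
  split_ifs at hgq <;> omega

lemma collectDonors (h : OnlyDonorsMoved N picks U i own) (hi : i < N / 2) :
    OnlyDonorsMoved N picks U (i + 1) (collectDonors N picks U own (Finset.Ico i N) i) := by
  constructor
  · intro g hg
    have := h.own_eq_or g hg
    simp only [_root_.collectDonors, h.isDonor_iff hi hg]
    split_ifs <;> omega
  · intro _ g hg hrow hcol
    have := h.own_eq_or g hg
    simp only [_root_.collectDonors, h.isDonor_iff hi hg]
    split_ifs <;> omega

lemma update (h : OnlyDonorsMoved N picks U i own) (hi : i + 1 < N / 2)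
    (hg : IsDonor N picks U own (Finset.Ico i N) g) :
    OnlyDonorsMoved N picks U (i + 1) (Function.update own g i) := by
  refine ⟨fun g' hg' => ?_, fun _ => by omega⟩
  have := h.own_eq_or g' hg'
  rw [Function.update_apply]
  split_ifs with hgg
  · subst hgg
    exact Or.inr ⟨hg.2.1, hg.2.2, by omega⟩
  · omega

lemma succ (h : OnlyDonorsMoved N picks U i own) (hi : i + 1 < N / 2) :
    OnlyDonorsMoved N picks U (i + 1) own :=
  ⟨fun g hg => by have := h.own_eq_or g hg; omega, fun _ => by omega⟩

/-- The exchange puts top items of the first half of the columns, but never two of them, into the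
parts of the second half, whose own items in the rows `0` and `1` are worthless to the agent. -/
lemma of_mem_partOf_rebundle (h : OnlyDonorsMoved N picks U i own) (hi : i < N / 2) (hq : i < q)
    (hqN : q < N) (hnd : ¬IsDonor N picks U own (Finset.Ico i N) g)
    (hg : g ∈ partOf U (rebundle N i picks U own (Finset.Ico i N)) q) :
    (q < N / 2 ∧ rrCol N picks g = q ∧ 1 ≤ rrRow N picks g) ∨
      (N / 2 ≤ q ∧ ((rrCol N picks g = q ∧ 2 ≤ rrRow N picks g) ∨
        (rrCol N picks g = i + (q - N / 2) + 1 ∧ rrRow N picks g = 0))) := by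
  obtain ⟨hgU, hgq⟩ := Finset.mem_filter.1 hg
  have hlt : rrCol N picks g < N := Nat.mod_lt _ (by omega)
  have := h.own_eq_or g hgU
  rw [h.isDonor_iff hi hgU] at hnd
  simp only [rebundle, InPlace, hgU, true_and, Finset.mem_Ico, swapLabel] at hgq
  split_ifs at hgq <;> omega

end OnlyDonorsMoved

end Stage

namespace FairInstance

section Stage

variable {n m N i q : ℕ} {I : FairInstance n m} {a : Fin n} {picks : List (Fin m)}
  {U : Finset (Fin m)} {own : Fin m → ℕ} {g : Fin m} {choose : ChoiceRule n m}

lemma prepare_cases {A : Finset ℕ} (hi : i ∈ A) :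
    (i + 1 = N / 2 ∧ I.prepare N picks U i a own A =
      (collectDonors N picks U own A i, collectDonors N picks U own A i)) ∨
    (i + 1 ≠ N / 2 ∧ ∃ g, IsDonor N picks U own A g ∧ 0 < I.val a g ∧
      I.prepare N picks U i a own A = (Function.update own g i, Function.update own g i)) ∨
    (i + 1 ≠ N / 2 ∧ (∀ g, IsDonor N picks U own A g → ¬0 < I.val a g) ∧
      I.prepare N picks U i a own A = (own, rebundle N i picks U own A)) := by
  rw [prepare, if_neg (not_not.2 hi)]
  split_ifs with hlast
  · exact Or.inl ⟨hlast, rfl⟩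
  split
  · next g hg => exact Or.inr (Or.inl ⟨hlast, g, by simpa [and_assoc] using List.find?_some hg⟩)
  · next hnone =>
    refine Or.inr (Or.inr ⟨hlast, fun g hdon hpos => ?_, rfl⟩)
    exact List.find?_eq_none.1 hnone g (List.mem_finRange g) (decide_eq_true ⟨hdon, hpos⟩)

lemma value_collectDonors_lt (hU : ∀ g ∈ U, g ∈ picks) (hdom : I.ColumnDominates a N i picks U)
    (hown : OnlyDonorsMoved N picks U i own)
    (hpos : 0 < I.value a (partOf U (rrCol N picks) i)) (hi : i + 1 = N / 2) (hq : i < q) :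
    I.value a (partOf U (collectDonors N picks U own (Finset.Ico i N) i) q) <
      I.value a (partOf U (collectDonors N picks U own (Finset.Ico i N) i) i) := by
  have hsub := hown.partOf_subset_column
    (collectDonors_eq_or (N := N) (picks := picks) (U := U) (A := Finset.Ico i N)) hq
  refine (hdom.value_lt_of_rrRow_ne hU (r := 0) (by exact_mod_cast hpos)
    (Finset.filter_subset _ _) ((injOn_rrRow_partOf hU q).mono (Finset.coe_subset.2 hsub))
    (fun g hg => ?_) fun g hg => ?_).trans_le
    (value_mono a (hown.column_subset_partOf (by omega) collectDonors_eq_or))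
  · rw [(Finset.mem_filter.1 (hsub hg)).2]
    exact hq.le
  · have := hown.two_le_rrRow_of_mem_partOf_collectDonors (by omega) (by omega) hg
    omega

lemma value_update_lt (hU : ∀ g ∈ U, g ∈ picks) (hdom : I.ColumnDominates a N i picks U)
    (hown : OnlyDonorsMoved N picks U i own) (hi : i < N / 2)
    (hg : IsDonor N picks U own (Finset.Ico i N) g) (hpos : 0 < I.val a g) (hq : i < q) :
    I.value a (partOf U (Function.update own g i) q) <
      I.value a (partOf U (Function.update own g i) i) := by
  have hgcol := hg.2.2
  calc I.value a (partOf U (Function.update own g i) q)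
      ≤ I.value a (partOf U (rrCol N picks) q) :=
        value_mono a (hown.partOf_subset_column (update_eq_or g) hq)
    _ ≤ I.value a (partOf U (rrCol N picks) i) := hdom.value_column_le hU hq.le
    _ < I.value a (partOf U (Function.update own g i) i) :=
        value_lt_value_of_mem_of_notMem (g := g)
          (hown.column_subset_partOf hi (update_eq_or g))
          (Finset.mem_filter.2 ⟨hg.1.1, Function.update_self g i own⟩)
          (fun hgi => by have := (Finset.mem_filter.1 hgi).2; omega) hpos

lemma column_subset_partOf_rebundle (hown : OnlyDonorsMoved N picks U i own) (hi : i < N / 2) :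
    partOf U (rrCol N picks) i ⊆ partOf U (rebundle N i picks U own (Finset.Ico i N)) i := by
  intro g hg
  obtain ⟨hgU, hcol⟩ := Finset.mem_filter.1 hg
  exact Finset.mem_filter.2
    ⟨hgU, rebundle_eq_of_own_eq ((hown.own_eq hgU (by omega)).trans hcol)⟩

/-- The parts of the first half miss their items in row `0`, and those of the second half consist,
up to worthless items, of rows `≠ 1`. -/
lemma value_rebundle_lt (hU : ∀ g ∈ U, g ∈ picks) (hdom : I.ColumnDominates a N i picks U)
    (hown : OnlyDonorsMoved N picks U i own)
    (hrich : 1 < I.value a (partOf U (rrCol N picks) i)) (hi : i < N / 2)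
    (hzero : ∀ g, IsDonor N picks U own (Finset.Ico i N) g → ¬0 < I.val a g) (hq : i < q)
    (hqN : q < N) :
    I.value a (partOf U (rebundle N i picks U own (Finset.Ico i N)) q) <
      I.value a (partOf U (rebundle N i picks U own (Finset.Ico i N)) i) := by
  set S := (partOf U (rebundle N i picks U own (Finset.Ico i N)) q).filter fun g => 0 < I.val a g
    with hS
  have hSU : S ⊆ U := (Finset.filter_subset _ _).trans (Finset.filter_subset _ _)
  have hmem (g : Fin m) (hg : g ∈ S) := hown.of_mem_partOf_rebundle hi hq hqN
    (fun hd => hzero g hd (Finset.mem_filter.1 hg).2) (Finset.mem_filter.1 hg).1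
  have hinj : Set.InjOn (rrRow N picks) S := fun g hg h hh hrow =>
    eq_of_rrRow_eq_of_rrCol_eq (hU g (hSU hg)) hrow (by
      have := hmem g hg
      have := hmem h hh
      omega)
  have hcol (g : Fin m) (hg : g ∈ S) : i ≤ rrCol N picks g := by
    have := hmem g hg
    omega
  rw [← value_filter_val_pos, ← hS]
  refine lt_of_lt_of_le ?_ (value_mono a (column_subset_partOf_rebundle hown hi))
  by_cases hqh : q < N / 2
  · refine hdom.value_lt_of_rrRow_ne hU (r := 0) (by push_cast; linarith) hSU hinj hcol
      fun g hg => ?_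
    have := hmem g hg
    omega
  · refine hdom.value_lt_of_rrRow_ne hU (r := 1) (by exact_mod_cast hrich) hSU hinj hcol
      fun g hg => ?_
    have := hmem g hg
    omega

lemma prepare_spec (hU : ∀ g ∈ U, g ∈ picks) (hdom : I.ColumnDominates a N i picks U)
    (hown : OnlyDonorsMoved N picks U i own)
    (hrich : 1 < I.value a (partOf U (rrCol N picks) i)) (hi : i < N / 2) :
    let M := I.prepare N picks U i a own (Finset.Ico i N)
    OnlyDonorsMoved N picks U (i + 1) M.1 ∧
      I.value a (partOf U (rrCol N picks) i) ≤ I.value a (partOf U M.2 i) ∧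
      ∀ q ∈ Finset.Ico i N, q ≠ i → I.value a (partOf U M.2 q) < I.value a (partOf U M.2 i) := by
  have hiN : i ∈ Finset.Ico i N := Finset.mem_Ico.2 ⟨le_rfl, by omega⟩
  have hlt {q : ℕ} (hq : q ∈ Finset.Ico i N) (hqi : q ≠ i) : i < q :=
    (Finset.mem_Ico.1 hq).1.lt_of_ne' hqi
  obtain ⟨hlast, hM⟩ | ⟨hlast, g, hg, hpos, hM⟩ | ⟨hlast, hzero, hM⟩ :=
    I.prepare_cases (a := a) (N := N) (picks := picks) (U := U) (own := own) hiN
  · rw [hM]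
    exact ⟨hown.collectDonors hi,
      value_mono a (hown.column_subset_partOf hi collectDonors_eq_or),
      fun q hq hqi => value_collectDonors_lt hU hdom hown (by linarith) hlast (hlt hq hqi)⟩
  · rw [hM]
    exact ⟨hown.update (by omega) hg,
      value_mono a (hown.column_subset_partOf hi (update_eq_or g)),
      fun q hq hqi => value_update_lt hU hdom hown hi hg hpos (hlt hq hqi)⟩
  · rw [hM]
    exact ⟨hown.succ (by omega), value_mono a (column_subset_partOf_rebundle hown hi),
      fun q hq hqi => value_rebundle_lt hU hdom hown hrich hi hzero (hlt hq hqi)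
        (Finset.mem_Ico.1 hq).2⟩

lemma Rational.choose_eq (hch : I.Rational choose) {A : Finset ℕ} {P : ℕ → Finset (Fin m)}
    (hi : i ∈ A) (h : ∀ q ∈ A, q ≠ i → I.value a (P q) < I.value a (P i)) :
    choose a A P = i := by
  by_contra hne
  obtain ⟨hmem, hmax⟩ := hch a A P ⟨i, hi⟩
  exact (hmax i hi).not_gt (h _ hmem hne)

lemma exists_pickingPhase_append_eq (hch : I.Rational choose) (hU : ∀ g ∈ U, g ∈ picks)
    (L : List (Fin n)) (hlen : i + L.length ≤ N / 2) (hown : OnlyDonorsMoved N picks U i own)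
    (hdom : ∀ j (hj : j < L.length), I.ColumnDominates L[j] N (i + j) picks U)
    (hrich : ∀ j (hj : j < L.length), 1 < I.value L[j] (partOf U (rrCol N picks) (i + j))) :
    ∃ (bundles : List (Finset (Fin m))) (own' : Fin m → ℕ), bundles.length = L.length ∧
      OnlyDonorsMoved N picks U (i + L.length) own' ∧
      (∀ j (hj : j < L.length),
        I.value L[j] (partOf U (rrCol N picks) (i + j)) ≤ I.value L[j] (bundles.getD j ∅)) ∧
      ∀ rest, I.pickingPhase choose N picks U (L ++ rest) i own (Finset.Ico i N) =
        let r := I.pickingPhase choose N picks U rest (i + L.length) own'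
          (Finset.Ico (i + L.length) N)
        (bundles ++ r.1, r.2) := by
  induction L generalizing i own with
  | nil => exact ⟨[], own, rfl, hown, by simp, fun rest => rfl⟩
  | cons a L ih =>
    rw [List.length_cons] at hlen
    have hshift (j : ℕ) : i + (j + 1) = i + 1 + j := by omega
    obtain ⟨hown', hvalue, hlt⟩ := prepare_spec (i := i) (a := a) hU (hdom 0 (by simp)) hown
      (hrich 0 (by simp)) (by omega)
    have htakes := hch.choose_eq (Finset.mem_Ico.2 ⟨le_rfl, by omega⟩) hlt
    have herase : (Finset.Ico i N).erase i = Finset.Ico (i + 1) N := by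
      rw [Finset.Ico_erase_left, ← Finset.Ico_add_one_left_eq_Ioo]
    obtain ⟨bundles, own', hbundles, hown'', hvalues, hphase⟩ := ih (by omega) hown'
      (fun j hj => hshift j ▸ hdom (j + 1) (by simpa using hj))
      (fun j hj => hshift j ▸ hrich (j + 1) (by simpa using hj))
    refine ⟨partOf U (I.prepare N picks U i a own (Finset.Ico i N)).2 i :: bundles, own',
      congrArg (· + 1) hbundles, hshift L.length ▸ hown'', ?_, fun rest => ?_⟩
    · rintro (_ | j) hj
      · exact hvalue
      · rw [hshift]
        exact hvalues j (by simpa using hj)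
    · rw [List.cons_append, pickingPhase]
      simp only [htakes, if_true, herase, hphase, List.length_cons, hshift L.length,
        List.cons_append]

end Stage

end FairInstance

/-! ### The whole algorithm -/

lemma one_le_stageOf (N i : ℕ) : 1 ≤ stageOf N i := by
  unfold stageOf
  split_ifs <;> omega

lemma stageOf_of_le {N i : ℕ} (hi : i ≤ N / 2) : stageOf N i = 1 := by
  unfold stageOf
  split_ifs <;> rfl

lemma stageOf_of_lt {N i : ℕ} (hN : 1 < N) (hi : N / 2 < i) :
    stageOf N i = 1 + stageOf (N - N / 2) (i - N / 2) := by
  rw [stageOf, if_neg (by omega), if_neg (by omega)]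

lemma stageOf_mono (N : ℕ) : Monotone (stageOf N) := by
  induction N using Nat.strong_induction_on with
  | _ N ih =>
    intro i j hij
    rcases le_or_gt i (N / 2) with hi | hi
    · rw [stageOf_of_le hi]
      exact one_le_stageOf N j
    rcases le_or_gt N 1 with hN | hN
    · rw [stageOf, if_pos hN]
      exact one_le_stageOf N j
    · rw [stageOf_of_lt hN hi, stageOf_of_lt hN (hi.trans_le hij)]
      exact Nat.add_le_add_left (ih (N - N / 2) (by omega) (by omega)) 1

namespace FairInstance

variable {n m : ℕ} {I : FairInstance n m} {choose : ChoiceRule n m}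

lemma exists_pickingPhase_take_append_eq (hch : I.Rational choose) {L : List (Fin n)}
    (U : Finset (Fin m)) {k : ℕ} (hL : 2 ≤ L.length) (hk : k ≤ L.length / 2)
    (hrich : ∀ j (hj : j < k), 1 < I.value L[j] (I.column L U j)) :
    ∃ (bundles : List (Finset (Fin m))) (own' : Fin m → ℕ), bundles.length = k ∧
      OnlyDonorsMoved L.length (I.roundRobin L U) U k own' ∧
      (∀ j (hj : j < k), I.value L[j] (I.column L U j) ≤ I.value L[j] (bundles.getD j ∅)) ∧
      ∀ rest, I.pickingPhase choose L.length (I.roundRobin L U) U (L.take k ++ rest) 0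
          (rrCol L.length (I.roundRobin L U)) (Finset.range L.length) =
        let r := I.pickingPhase choose L.length (I.roundRobin L U) U rest k own'
          (Finset.Ico k L.length)
        (bundles ++ r.1, r.2) := by
  have htake : (L.take k).length = k := List.length_take_of_le (by omega)
  obtain ⟨bundles, own', hbundles, hown, hvalue, hphase⟩ :=
    exists_pickingPhase_append_eq (i := 0) hch
      (fun g => (mem_roundRobin_iff (L := L) (List.ne_nil_of_length_pos (by omega))).2) (L.take k)
      (by omega) (OnlyDonorsMoved.zero hL)
      (fun j hj => by
        simpa only [zero_add, List.getElem_take] using columnDominates_roundRobin U (by omega))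
      (fun j hj => by
        simpa only [zero_add, List.getElem_take, column] using hrich j (by omega))
  simp only [zero_add, List.getElem_take, htake] at hbundles hown hvalue hphase
  exact ⟨bundles, own', hbundles, hown, hvalue, Finset.range_eq_Ico _ ▸ hphase⟩

lemma value_column_le_value_boundedProp (hch : I.Rational choose) {L : List (Fin n)}
    (U : Finset (Fin m)) {i : ℕ} (hL : 2 ≤ L.length) (hi : i < L.length / 2)
    (hrich : ∀ j (hj : j ≤ i), 1 < I.value L[j] (I.column L U j)) :
    I.value L[i] (I.column L U i) ≤ I.value L[i] ((I.boundedProp choose L U).getD i ∅) := by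
  obtain ⟨bundles, own', hbundles, -, hvalue, hphase⟩ :=
    exists_pickingPhase_take_append_eq hch U hL (k := i + 1) (by omega)
      fun j hj => hrich j (by omega)
  have hsplit : L.take (L.length / 2) = L.take (i + 1) ++ (L.take (L.length / 2)).drop (i + 1) := by
    conv_lhs => rw [← List.take_append_drop (i + 1) (L.take (L.length / 2))]
    rw [List.take_take, min_eq_left (by omega)]
  rw [boundedProp, if_neg (by omega)]
  simp only [congrArg Prod.fst (hsplit ▸ hphase _)]
  rw [List.append_assoc, List.getD_append _ _ _ _ (by omega)]
  exact hvalue i (by omega)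

lemma getD_boundedProp_add (hch : I.Rational choose) {L : List (Fin n)} (U : Finset (Fin m))
    (hL : 2 ≤ L.length)
    (hrich : ∀ j (hj : j < L.length / 2), 1 < I.value L[j] (I.column L U j)) (k : ℕ) :
    (I.boundedProp choose L U).getD (L.length / 2 + k) ∅ =
      (I.boundedProp choose (L.drop (L.length / 2))
        (I.lowerRight L U 2 (L.length / 2))).getD k ∅ := by
  obtain ⟨bundles, own', hbundles, hown, -, hphase⟩ :=
    exists_pickingPhase_take_append_eq hch U hL le_rfl hrich
  have hleft : (U.filter fun g => own' g ∈ Finset.Ico (L.length / 2) L.length) =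
      I.lowerRight L U 2 (L.length / 2) := by
    refine Finset.filter_congr fun g hg => ?_
    have := hown.own_eq_or g hg
    have := hown.own_lt_half rfl g hg
    have : rrCol L.length (I.roundRobin L U) g < L.length := Nat.mod_lt _ (by omega)
    rw [Finset.mem_Ico]
    omega
  specialize hphase []
  simp only [List.append_nil, pickingPhase, hleft] at hphase
  rw [boundedProp, if_neg (by omega)]
  simp only [hphase]
  rw [List.getD_append_right _ _ _ _ (by omega), hbundles, Nat.add_sub_cancel_left]

lemma value_column_sub_le_value_boundedProp (hch : I.Rational choose) {L : List (Fin n)}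
    (hL : L.Nodup) (U : Finset (Fin m)) {i : ℕ} (hi : i < L.length)
    (hrich : ∀ j (hj : j ≤ i),
      2 * (stageOf L.length (j + 1) : ℝ) - 1 < I.value L[j] (I.column L U j)) :
    I.value L[i] (I.column L U i) - 2 * ((stageOf L.length (i + 1) : ℝ) - 1) ≤
      I.value L[i] ((I.boundedProp choose L U).getD i ∅) := by
  induction hN : L.length using Nat.strong_induction_on generalizing L U i with
  | _ N ih =>
    subst hN
    have hone (k : ℕ) : (1 : ℝ) ≤ stageOf L.length k := by exact_mod_cast one_le_stageOf _ k
    rcases le_or_gt L.length 1 with hL1 | hL1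
    · rw [boundedProp, if_pos hL1, List.getD_eq_getElem _ _ (by simpa using hi), List.getElem_map]
      have : I.value L[i] (I.column L U i) ≤ I.value L[i] U :=
        value_mono L[i] (Finset.filter_subset _ _)
      linarith [hone (i + 1)]
    rcases lt_or_ge i (L.length / 2) with hfirst | hsecond
    · rw [stageOf_of_le hfirst, Nat.cast_one, sub_self, mul_zero, sub_zero]
      exact value_column_le_value_boundedProp hch U hL1 hfirst fun j hj => by
        linarith [hrich j hj, hone (j + 1)]
    obtain ⟨k, rfl⟩ := Nat.exists_eq_add_of_le hsecond
    have hdrop : (L.drop (L.length / 2)).length = L.length - L.length / 2 := List.length_drop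
    have hstage (j : ℕ) : (stageOf L.length (L.length / 2 + j + 1) : ℝ) =
        1 + stageOf (L.drop (L.length / 2)).length (j + 1) := by
      rw [stageOf_of_lt hL1 (by omega), hdrop, add_assoc, Nat.add_sub_cancel_left]
      push_cast
      rfl
    have hcolumn (j : ℕ) (hj : L.length / 2 + j < L.length) :=
      value_column_le_add_value_column_drop (I := I) hL U 2 hj L[L.length / 2 + j]
    have hrec := ih _ (by omega) (hL.sublist (List.drop_sublist (L.length / 2) L))
      (I.lowerRight L U 2 (L.length / 2)) (i := k) (by omega) (fun j hj => by
        rw [List.getElem_drop]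
        have := hrich (L.length / 2 + j) (by omega)
        rw [hstage] at this
        linarith [hcolumn j (by omega)]) rfl
    rw [List.getElem_drop] at hrec
    rw [hstage, getD_boundedProp_add hch U hL1 fun j hj => by
      linarith [hrich j (by omega), hone (j + 1)]]
    linarith [hcolumn k hi]

/-- Since stages are monotone in the position and shares antitone, everyone who arrives before an
agent with a share above `2 * stageOf` has such a share herself. -/
lemma prop_sub_le_value_received (hch : I.Rational choose) {τ : Equiv.Perm (Fin n)}
    (hτ : Antitone fun i => I.value (τ i) Finset.univ) (i : Fin n) :
    I.prop (τ i) - 2 * stageOf n (i + 1) ≤ I.value (τ i) (I.received choose τ i) := by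
  rcases le_or_gt (I.prop (τ i)) (2 * stageOf n (i + 1)) with hpoor | hrich
  · linarith [value_nonneg (I := I) (τ i) (I.received choose τ i)]
  have hn : (0 : ℝ) < n := by exact_mod_cast i.pos
  have hlen : (List.ofFn τ).length = n := List.length_ofFn
  have hget (j : ℕ) (hj : j < n) : (List.ofFn τ)[j] = τ ⟨j, hj⟩ := List.getElem_ofFn _
  have hcolumn (j : ℕ) (hj : j < n) : I.prop (τ ⟨j, hj⟩) - 1 ≤
      I.value (τ ⟨j, hj⟩) (I.column (List.ofFn τ) Finset.univ j) := by
    have := value_le_length_mul (I := I) (L := List.ofFn τ) Finset.univ (i := j) (by omega)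
    rw [hget j hj, hlen] at this
    rw [prop, sub_le_iff_le_add, div_le_iff₀' hn]
    exact this
  have hprop (j : ℕ) (hj : j ≤ i) : I.prop (τ i) ≤ I.prop (τ ⟨j, by omega⟩) :=
    div_le_div_of_nonneg_right (hτ (Fin.mk_le_of_le_val hj)) hn.le
  have hreceived := value_column_sub_le_value_boundedProp hch (L := List.ofFn τ)
    (List.nodup_ofFn.2 τ.injective) Finset.univ (i := i) (by omega) fun j hj => by
      have hstage : (stageOf n (j + 1) : ℝ) ≤ stageOf n (i + 1) := by
        exact_mod_cast stageOf_mono n (by omega)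
      rw [hget j (by omega), hlen]
      linarith [hcolumn j (by omega), hprop j hj]
  rw [hget i i.isLt, hlen] at hreceived
  unfold received
  linarith [hcolumn i i.isLt]

end FairInstance

/-! ### Sorting on the random access machine -/

/-- The order in which the numbers are sorted: by decreasing `W`, ties by increasing number. -/
def sortKey (W : ℕ → ℝ) (a : ℕ) : ℝᵒᵈ ×ₗ ℕ := toLex (OrderDual.toDual (W a), a)

open scoped Classical in
/-- The number of elements of `{0, …, k - 1}` that come before `a` in the order of `sortKey W`. -/
noncomputable def rank (W : ℕ → ℝ) (k a : ℕ) : ℕ :=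
  ((Finset.range k).filter fun b => sortKey W b < sortKey W a).card

section Rank

variable {W : ℕ → ℝ} {a b : ℕ}

lemma sortKey_injective : Function.Injective (sortKey W) := fun _ _ h =>
  congrArg (fun x => (ofLex x).2) h

lemma sortKey_lt_sortKey_iff_of_le (h : a ≤ b) : sortKey W b < sortKey W a ↔ ¬W b ≤ W a := by
  simp [sortKey, Prod.Lex.toLex_lt_toLex, h.not_gt]

lemma sortKey_lt_sortKey_iff_of_lt (h : b < a) : sortKey W b < sortKey W a ↔ W a ≤ W b := by
  simp [sortKey, Prod.Lex.toLex_lt_toLex, h, le_iff_lt_or_eq, eq_comm]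

open scoped Classical in
lemma rank_succ (W : ℕ → ℝ) (k a : ℕ) :
    rank W (k + 1) a = rank W k a + if sortKey W k < sortKey W a then 1 else 0 := by
  simp only [rank, Finset.card_filter, Finset.sum_range_succ]

lemma exists_perm_rank (W : ℕ → ℝ) (n : ℕ) :
    ∃ τ : Equiv.Perm (Fin n), (∀ i, rank W n (τ i) = i) ∧ Antitone fun i => W (τ i) := by
  classical
  set τ := Tuple.sort fun a : Fin n => sortKey W a
  have hmono : StrictMono fun i => sortKey W (τ i) :=
    (Tuple.monotone_sort fun a : Fin n => sortKey W a).strictMono_of_injective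
      (sortKey_injective.comp (Fin.val_injective.comp τ.injective))
  refine ⟨τ, fun i => ?_, fun i j hij => ?_⟩
  · calc rank W n (τ i)
        = (Finset.univ.filter fun b : Fin n => sortKey W b < sortKey W (τ i)).card := by
          rw [rank, Finset.card_filter, Finset.card_filter, Finset.sum_range]
      _ = ((Finset.Iio i).map τ.toEmbedding).card := by
          congr 1
          ext b
          obtain ⟨j, rfl⟩ := τ.surjective b
          simp [hmono.lt_iff_lt]
      _ = i := by rw [Finset.card_map, Fin.card_Iio]
  · have := hmono.monotone hij
    rw [sortKey, sortKey, Prod.Lex.toLex_le_toLex] at this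
    exact this.elim (fun h => (OrderDual.toDual_lt_toDual.1 h).le) fun h =>
      (OrderDual.toDual_inj.1 h.1).ge

lemma injOn_rank (W : ℕ → ℝ) (n : ℕ) : Set.InjOn (rank W n) (Set.Iio n) := by
  obtain ⟨τ, hτ, -⟩ := exists_perm_rank W n
  intro a ha b hb hab
  obtain ⟨i, hi⟩ := τ.surjective ⟨a, ha⟩
  obtain ⟨j, hj⟩ := τ.surjective ⟨b, hb⟩
  have hia := hτ i
  have hjb := hτ j
  rw [hi] at hia
  rw [hj] at hjb
  have hij : i = j := Fin.ext (hia.symm.trans (hab.trans hjb))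
  exact congrArg Fin.val (hi.symm.trans ((congrArg τ hij).trans hj))

end Rank

/-- Started in memory `s`, the program halts within `T` steps in a memory that satisfies `Q`. -/
def Runs (p : Program) (s : Mem) (Q : Mem → Prop) (T : ℕ) : Prop :=
  ∃ s' t, Exec p s s' t ∧ t ≤ T ∧ Q s'

namespace Runs

variable {p q : Program} {b : RegTest} {c : Instr} {s : Mem} {Q R : Mem → Prop} {T T' : ℕ}

lemma instr (h : Q (c.apply s)) : Runs (.instr c) s Q 1 :=
  ⟨_, _, .instr c s, le_rfl, h⟩

lemma seq (hp : Runs p s Q T) (hq : ∀ s', Q s' → Runs q s' R T') :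
    Runs (.seq p q) s R (T + T') := by
  obtain ⟨s', t, hexec, ht, hs'⟩ := hp
  obtain ⟨s'', t', hexec', ht', hs''⟩ := hq s' hs'
  exact ⟨s'', _, .seq hexec hexec', add_le_add ht ht', hs''⟩

lemma instr_seq (hq : Runs q (c.apply s) R T) : Runs (.seq (.instr c) q) s R (1 + T) :=
  (instr (Q := (· = c.apply s)) rfl).seq fun _ h => h ▸ hq

lemma cond (hp : b.Holds s → Runs p s Q T) (hq : ¬b.Holds s → Runs q s Q T) :
    Runs (.cond b p q) s Q (T + 1) := by
  by_cases hb : b.Holds s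
  · obtain ⟨s', t, hexec, ht, hs'⟩ := hp hb
    exact ⟨s', _, .cond_true hb hexec, by omega, hs'⟩
  · obtain ⟨s', t, hexec, ht, hs'⟩ := hq hb
    exact ⟨s', _, .cond_false hb hexec, by omega, hs'⟩

lemma mono (h : Runs p s Q T) (hQ : ∀ s', Q s' → R s') (hT : T ≤ T') : Runs p s R T' := by
  obtain ⟨s', t, hexec, ht, hs'⟩ := h
  exact ⟨s', t, hexec, ht.trans hT, hQ s' hs'⟩

lemma loop {K : ℕ} (Inv : ℕ → Mem → Prop)
    (hguard : ∀ k ≤ K, ∀ s, Inv k s → (b.Holds s ↔ k < K))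
    (hstep : ∀ k < K, ∀ s, Inv k s → Runs p s (Inv (k + 1)) T) (hs : Inv 0 s) :
    Runs (.loop b p) s (Inv K) (K * (T + 1) + 1) := by
  induction K generalizing Inv s with
  | zero =>
    exact ⟨s, 1, .loop_false fun h => lt_irrefl 0 ((hguard 0 le_rfl s hs).1 h), by simp, hs⟩
  | succ K ih =>
    obtain ⟨s', t, hexec, ht, hs'⟩ := hstep 0 K.succ_pos s hs
    obtain ⟨s'', t', hexec', ht', hs''⟩ := ih (fun k => Inv (k + 1))
      (fun k hk s h => by rw [hguard (k + 1) (by omega) s h, Nat.add_lt_add_iff_right])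
      (fun k hk => hstep (k + 1) (by omega)) hs'
    refine ⟨s'', _, .loop_true ((hguard 0 (by omega) s hs).2 K.succ_pos) hexec hexec', ?_, hs''⟩
    rw [Nat.succ_mul]
    omega

end Runs

/-- Adds the entry at address `nreg 6` to the real register `0` and moves on to the next entry. -/
def rowSumBody : Program :=
  .seq (.instr (.rload 1 6)) <| .seq (.instr (.radd 0 0 1)) <| .seq (.instr (.nadd 6 6 2)) <|
    .instr (.nadd 5 5 2)

/-- Stores the sum of row `a = nreg 3 - 1` in cell `a`. This overwrites no entry that is still
needed, because the next rows begin at the address `(a + 1) * m`. -/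
def rowSumsBody : Program :=
  .seq (.instr (.rzero 0)) <| .seq (.instr (.nconst 5 1)) <| .seq (.loop (.nle 5 1) rowSumBody) <|
    .seq (.instr (.nsub 4 3 2)) <| .seq (.instr (.rstore 4 0)) <| .instr (.nadd 3 3 2)

/-- Adds `1` to `nreg 7` if the number `nreg 5 - 1` comes before the number `nreg 3 - 1` in the
order of `sortKey`. The assignment to register `8` has no purpose. -/
def rankBody : Program :=
  .seq (.instr (.nsub 6 5 2)) <| .seq (.instr (.rload 1 6)) <|
    .seq (.cond (.nle 3 5)
      (.cond (.rle 1 0) (.instr (.nconst 8 0)) (.instr (.nadd 7 7 2)))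
      (.cond (.rle 0 1) (.instr (.nadd 7 7 2)) (.instr (.nconst 8 0)))) <|
    .instr (.nadd 5 5 2)

/-- Stores `a = nreg 3 - 1` in the cell whose address is the rank of `a`. -/
def ranksBody : Program :=
  .seq (.instr (.nsub 4 3 2)) <| .seq (.instr (.rload 0 4)) <| .seq (.instr (.nconst 7 0)) <|
    .seq (.instr (.nconst 5 1)) <| .seq (.loop (.nle 5 0) rankBody) <|
    .seq (.instr (.nstore 7 4)) <| .instr (.nadd 3 3 2)

/-- Lists the rows of the matrix by decreasing sums. Register `2` holds the constant `1`, and the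
registers `3` and `5` count the rounds of the outer and the inner loops, starting from `1` since the
tests compare by `≤`. -/
def orderProgram : Program :=
  .seq (.instr (.nconst 2 1)) <| .seq (.instr (.nconst 3 1)) <|
    .seq (.loop (.nle 3 0) rowSumsBody) <| .seq (.instr (.nconst 3 1)) <|
    .loop (.nle 3 0) ranksBody

/-- Loop invariant: the first `k` entries from address `s.nreg 6` on have been added up. -/
structure RowSumInv (s : Mem) (k : ℕ) (s' : Mem) : Prop where
  nreg_of_le : ∀ x ≤ 4, s'.nreg x = s.nreg x
  nreg_five : s'.nreg 5 = k + 1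
  nreg_six : s'.nreg 6 = s.nreg 6 + k
  rreg_zero : s'.rreg 0 = ∑ j ∈ Finset.range k, s.rmem (s.nreg 6 + j)
  rmem_eq : s'.rmem = s.rmem

lemma runs_loop_rowSumBody {s : Mem} (h2 : s.nreg 2 = 1) (h5 : s.nreg 5 = 1) (hr : s.rreg 0 = 0) :
    Runs (.loop (.nle 5 1) rowSumBody) s (RowSumInv s (s.nreg 1)) (s.nreg 1 * 5 + 1) := by
  refine Runs.loop (RowSumInv s) (fun k _ s' h => ?_) (fun k _ s' h => ?_)
    ⟨fun _ _ => rfl, h5, rfl, by simpa using hr, rfl⟩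
  · simp only [RegTest.Holds, h.nreg_five, h.nreg_of_le 1 (by simp), Nat.succ_le_iff]
  · have h2' := (h.nreg_of_le 2 (by simp)).trans h2
    refine .instr_seq (.instr_seq (.instr_seq (.instr ⟨fun x hx => ?_, ?_, ?_, ?_, ?_⟩)))
    · simp [Instr.apply, h.nreg_of_le x hx, show x ≠ 5 by omega, show x ≠ 6 by omega]
    · simp [Instr.apply, h.nreg_five, h2']
    · simp [Instr.apply, h.nreg_six, h2', add_assoc]
    · simp [Instr.apply, h.rreg_zero, h.nreg_six, h.rmem_eq, Finset.sum_range_succ]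
    · exact h.rmem_eq

/-- Loop invariant: the first `a` cells hold the row sums, and the rows from number `a` on are
unchanged. -/
structure RowSumsInv (s : Mem) (a : ℕ) (s' : Mem) : Prop where
  nreg_of_le : ∀ x ≤ 2, s'.nreg x = s.nreg x
  nreg_three : s'.nreg 3 = a + 1
  nreg_six : s'.nreg 6 = a * s.nreg 1
  rmem_of_lt : ∀ k < a, s'.rmem k = ∑ j ∈ Finset.range (s.nreg 1), s.rmem (k * s.nreg 1 + j)
  rmem_of_le : ∀ k, a ≤ k → a * s.nreg 1 ≤ k → s'.rmem k = s.rmem k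

lemma RowSumsInv.sum_rmem_eq {s s' : Mem} {a : ℕ} (h : RowSumsInv s a s') :
    ∑ j ∈ Finset.range (s.nreg 1), s'.rmem (a * s.nreg 1 + j) =
      ∑ j ∈ Finset.range (s.nreg 1), s.rmem (a * s.nreg 1 + j) := by
  refine Finset.sum_congr rfl fun j hj => h.rmem_of_le _ ?_ (Nat.le_add_right _ _)
  exact (Nat.le_mul_of_pos_right a (Nat.zero_lt_of_lt (Finset.mem_range.1 hj))).trans
    (Nat.le_add_right _ _)

lemma runs_rowSumsBody {s s' : Mem} {a : ℕ} (h2 : s.nreg 2 = 1) (h : RowSumsInv s a s') :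
    Runs rowSumsBody s' (RowSumsInv s (a + 1)) (s.nreg 1 * 5 + 6) := by
  have h1' := h.nreg_of_le 1 (by simp)
  have h2' := (h.nreg_of_le 2 (by simp)).trans h2
  set s₁ := (Instr.nconst 5 1).apply ((Instr.rzero 0).apply s')
  have hs₁_nreg (x : ℕ) (hx : x ≠ 5) : s₁.nreg x = s'.nreg x := Function.update_of_ne hx _ _
  have hsum := runs_loop_rowSumBody (s := s₁) h2' rfl rfl
  rw [hs₁_nreg 1 (by simp), h1'] at hsum
  refine (Runs.instr_seq (.instr_seq (hsum.seq (T' := 3) fun s₂ h₂ => .instr_seq (.instr_seq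
    (.instr (?_ : RowSumsInv s (a + 1) _)))))).mono (fun _ h => h) (by omega)
  have hs₂_nreg (x : ℕ) (hx : x ≤ 4) : s₂.nreg x = s'.nreg x :=
    (h₂.nreg_of_le x hx).trans (hs₁_nreg x (by omega))
  have hs₂_row : s₂.nreg 3 - s₂.nreg 2 = a := by
    rw [hs₂_nreg 3 (by simp), hs₂_nreg 2 (by simp), h.nreg_three, h2', Nat.add_sub_cancel]
  have hs₂_sum : s₂.rreg 0 = ∑ j ∈ Finset.range (s.nreg 1), s.rmem (a * s.nreg 1 + j) := by
    rw [h₂.rreg_zero, hs₁_nreg 6 (by simp), h.nreg_six]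
    exact h.sum_rmem_eq
  have hs₂_rmem : s₂.rmem = s'.rmem := h₂.rmem_eq
  refine ⟨fun x hx => ?_, ?_, ?_, fun k hk => ?_, fun k hk hk' => ?_⟩
  · simp [Instr.apply, show x ≠ 3 by omega, show x ≠ 4 by omega, hs₂_nreg x (by omega),
      h.nreg_of_le x hx]
  · simp [Instr.apply, hs₂_nreg, h.nreg_three, h2']
  · simp [Instr.apply, h₂.nreg_six, hs₁_nreg, h.nreg_six, Nat.succ_mul]
  · rcases Nat.lt_succ_iff_lt_or_eq.1 hk with hk | rfl
    · simp [Instr.apply, hs₂_row, hk.ne, hs₂_rmem, h.rmem_of_lt k hk]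
    · simp [Instr.apply, hs₂_row, hs₂_sum]
  · rw [Nat.succ_mul] at hk'
    simp [Instr.apply, hs₂_row, show k ≠ a by omega, hs₂_rmem,
      h.rmem_of_le k (by omega) (by omega)]

lemma runs_loop_rowSumsBody {s : Mem} (h2 : s.nreg 2 = 1) (h3 : s.nreg 3 = 1)
    (h6 : s.nreg 6 = 0) :
    Runs (.loop (.nle 3 0) rowSumsBody) s (RowSumsInv s (s.nreg 0))
      (s.nreg 0 * (s.nreg 1 * 5 + 7) + 1) :=
  Runs.loop (RowSumsInv s)
    (fun a _ s' h => by
      simp only [RegTest.Holds, h.nreg_three, h.nreg_of_le 0 (by simp), Nat.succ_le_iff])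
    (fun _ _ _ h => runs_rowSumsBody h2 h)
    ⟨fun _ _ => rfl, h3, by simpa using h6, by simp, fun _ _ _ => rfl⟩

/-- Loop invariant: the numbers below `k` that come before `s.nreg 4` have been counted. -/
structure RankInv (s : Mem) (k : ℕ) (s' : Mem) : Prop where
  nreg_of_le : ∀ x ≤ 4, s'.nreg x = s.nreg x
  nreg_five : s'.nreg 5 = k + 1
  nreg_seven : s'.nreg 7 = rank s.rmem k (s.nreg 4)
  rreg_zero : s'.rreg 0 = s.rreg 0
  rmem_eq : s'.rmem = s.rmem
  nmem_eq : s'.nmem = s.nmem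

lemma runs_rankBody {s s' : Mem} {k : ℕ} (h2 : s.nreg 2 = 1) (h3 : s.nreg 3 = s.nreg 4 + 1)
    (hr : s.rreg 0 = s.rmem (s.nreg 4)) (h : RankInv s k s') :
    Runs rankBody s' (RankInv s (k + 1)) 6 := by
  have h2' := (h.nreg_of_le 2 (by simp)).trans h2
  have h3' := (h.nreg_of_le 3 (by simp)).trans h3
  set s₁ := (Instr.rload 1 6).apply ((Instr.nsub 6 5 2).apply s') with hs₁
  have hs₁_nreg (x : ℕ) (hx : x ≠ 6) : s₁.nreg x = s'.nreg x := Function.update_of_ne hx _ _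
  have hs₁_rreg_zero : s₁.rreg 0 = s.rmem (s.nreg 4) := h.rreg_zero.trans hr
  have hs₁_rreg_one : s₁.rreg 1 = s.rmem k := by
    simp [hs₁, Instr.apply, h.nreg_five, h2', h.rmem_eq]
  have hcount (hlt : sortKey s.rmem k < sortKey s.rmem (s.nreg 4)) :
      RankInv s (k + 1) ((Instr.nadd 5 5 2).apply ((Instr.nadd 7 7 2).apply s₁)) := by
    refine ⟨fun x hx => ?_, ?_, ?_, h.rreg_zero, h.rmem_eq, h.nmem_eq⟩
    · simp [Instr.apply, show x ≠ 5 by omega, show x ≠ 7 by omega, hs₁_nreg x (by omega),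
        h.nreg_of_le x hx]
    · simp [Instr.apply, hs₁_nreg, h.nreg_five, h2']
    · simp [Instr.apply, hs₁_nreg, h.nreg_seven, h2', rank_succ, hlt]
  have hskip (hlt : ¬sortKey s.rmem k < sortKey s.rmem (s.nreg 4)) :
      RankInv s (k + 1) ((Instr.nadd 5 5 2).apply ((Instr.nconst 8 0).apply s₁)) := by
    refine ⟨fun x hx => ?_, ?_, ?_, h.rreg_zero, h.rmem_eq, h.nmem_eq⟩
    · simp [Instr.apply, show x ≠ 5 by omega, show x ≠ 8 by omega, hs₁_nreg x (by omega),
        h.nreg_of_le x hx]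
    · simp [Instr.apply, hs₁_nreg, h.nreg_five, h2']
    · simp [Instr.apply, hs₁_nreg, h.nreg_seven, rank_succ, hlt]
  have hnle : (RegTest.nle 3 5).Holds s₁ ↔ s.nreg 4 ≤ k := by
    simp [RegTest.Holds, hs₁_nreg, h3', h.nreg_five]
  have hrle_one_zero : (RegTest.rle 1 0).Holds s₁ ↔ s.rmem k ≤ s.rmem (s.nreg 4) := by
    rw [RegTest.Holds, hs₁_rreg_one, hs₁_rreg_zero]
  have hrle_zero_one : (RegTest.rle 0 1).Holds s₁ ↔ s.rmem (s.nreg 4) ≤ s.rmem k := by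
    rw [RegTest.Holds, hs₁_rreg_one, hs₁_rreg_zero]
  refine .instr_seq (.instr_seq (.seq
    (Q := fun s₂ => RankInv s (k + 1) ((Instr.nadd 5 5 2).apply s₂)) (.cond (T := 1 + 1)
    (fun hb => ?_) fun hb => ?_) fun s₂ h₂ => .instr h₂))
  · have hkey := sortKey_lt_sortKey_iff_of_le (W := s.rmem) (hnle.1 hb)
    exact .cond (fun hb => .instr (hskip (mt hkey.1 (not_not.2 (hrle_one_zero.1 hb)))))
      fun hb => .instr (hcount (hkey.2 (mt hrle_one_zero.2 hb)))
  · have hkey := sortKey_lt_sortKey_iff_of_lt (W := s.rmem) (lt_of_not_ge (mt hnle.2 hb))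
    exact .cond (fun hb => .instr (hcount (hkey.2 (hrle_zero_one.1 hb))))
      fun hb => .instr (hskip (mt hkey.1 (mt hrle_zero_one.2 hb)))

lemma runs_loop_rankBody {s : Mem} (h2 : s.nreg 2 = 1) (h3 : s.nreg 3 = s.nreg 4 + 1)
    (h5 : s.nreg 5 = 1) (h7 : s.nreg 7 = 0) (hr : s.rreg 0 = s.rmem (s.nreg 4)) :
    Runs (.loop (.nle 5 0) rankBody) s (RankInv s (s.nreg 0)) (s.nreg 0 * 7 + 1) :=
  Runs.loop (RankInv s)
    (fun k _ s' h => by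
      simp only [RegTest.Holds, h.nreg_five, h.nreg_of_le 0 (by simp), Nat.succ_le_iff])
    (fun _ _ _ h => runs_rankBody h2 h3 hr h)
    ⟨fun _ _ => rfl, h5, by simpa [rank] using h7, rfl, rfl, rfl⟩

/-- Loop invariant: the numbers below `a` are stored in the cells given by their ranks. -/
structure RanksInv (s : Mem) (a : ℕ) (s' : Mem) : Prop where
  nreg_of_le : ∀ x ≤ 2, s'.nreg x = s.nreg x
  nreg_three : s'.nreg 3 = a + 1
  rmem_eq : s'.rmem = s.rmem
  nmem_rank : ∀ k < a, s'.nmem (rank s.rmem (s.nreg 0) k) = k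

lemma runs_ranksBody {s s' : Mem} {a : ℕ} (h2 : s.nreg 2 = 1) (ha : a < s.nreg 0)
    (h : RanksInv s a s') : Runs ranksBody s' (RanksInv s (a + 1)) (s.nreg 0 * 7 + 7) := by
  have h0' := h.nreg_of_le 0 (by simp)
  have h2' := (h.nreg_of_le 2 (by simp)).trans h2
  set s₁ := (Instr.nconst 5 1).apply ((Instr.nconst 7 0).apply
    ((Instr.rload 0 4).apply ((Instr.nsub 4 3 2).apply s')))
  have hs₁_nreg (x : ℕ) (hx : x ≤ 3) : s₁.nreg x = s'.nreg x := by
    simp [s₁, Instr.apply, show x ≠ 4 by omega, show x ≠ 5 by omega, show x ≠ 7 by omega]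
  have hs₁_nreg_four : s₁.nreg 4 = a := by simp [s₁, Instr.apply, h.nreg_three, h2']
  have hrank := runs_loop_rankBody (s := s₁) h2'
    (by rw [hs₁_nreg_four, hs₁_nreg 3 le_rfl, h.nreg_three]) rfl rfl
    (by simp [s₁, Instr.apply])
  rw [hs₁_nreg 0 (by simp), h0'] at hrank
  refine (Runs.instr_seq (.instr_seq (.instr_seq (.instr_seq (hrank.seq (T' := 2) fun s₂ h₂ =>
    .instr_seq (.instr (?_ : RanksInv s (a + 1) _))))))).mono (fun _ h => h) (by omega)
  have hs₂_nreg (x : ℕ) (hx : x ≤ 3) : s₂.nreg x = s'.nreg x :=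
    (h₂.nreg_of_le x (by omega)).trans (hs₁_nreg x hx)
  have hs₂_nreg_four : s₂.nreg 4 = a := (h₂.nreg_of_le 4 le_rfl).trans hs₁_nreg_four
  have hs₂_rank : s₂.nreg 7 = rank s.rmem (s.nreg 0) a := by
    rw [h₂.nreg_seven, hs₁_nreg_four, ← h.rmem_eq]
    rfl
  have hs₂_nmem : s₂.nmem = s'.nmem := h₂.nmem_eq
  refine ⟨fun x hx => ?_, ?_, h₂.rmem_eq.trans h.rmem_eq, fun k hk => ?_⟩
  · simp [Instr.apply, show x ≠ 3 by omega, hs₂_nreg x (by omega), h.nreg_of_le x hx]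
  · simp [Instr.apply, hs₂_nreg, h.nreg_three, h2']
  · rcases Nat.lt_succ_iff_lt_or_eq.1 hk with hk | rfl
    · have hne : rank s.rmem (s.nreg 0) k ≠ rank s.rmem (s.nreg 0) a :=
        (injOn_rank _ _).ne (hk.trans ha) ha hk.ne
      simp [Instr.apply, hs₂_rank, hne, hs₂_nmem, h.nmem_rank k hk]
    · simp [Instr.apply, hs₂_rank, hs₂_nreg_four]

lemma runs_loop_ranksBody {s : Mem} (h2 : s.nreg 2 = 1) (h3 : s.nreg 3 = 1) :
    Runs (.loop (.nle 3 0) ranksBody) s (RanksInv s (s.nreg 0))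
      (s.nreg 0 * (s.nreg 0 * 7 + 8) + 1) :=
  Runs.loop (RanksInv s)
    (fun a _ s' h => by
      simp only [RegTest.Holds, h.nreg_three, h.nreg_of_le 0 (by simp), Nat.succ_le_iff])
    (fun _ ha _ h => runs_ranksBody h2 ha h)
    ⟨fun _ _ => rfl, h3, rfl, by simp⟩

section Input

variable {n m : ℕ} (I : FairInstance n m)

lemma FairInstance.sum_rmem_input (a : Fin n) :
    ∑ j ∈ Finset.range m, I.input.rmem (a * m + j) = I.value a Finset.univ := by
  rw [FairInstance.value, ← Fin.sum_univ_eq_sum_range fun j => I.input.rmem (a * m + j)]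
  refine Finset.sum_congr rfl fun j _ => ?_
  have hlt : (a : ℕ) * m + j < n * m := by nlinarith [a.isLt, j.isLt]
  have hdiv : Fin.divNat ⟨a * m + j, hlt⟩ = a := by
    ext
    simp [Fin.coe_divNat, Nat.mul_add_div, mul_comm _ m, j.pos]
  have hmod : Fin.modNat ⟨a * m + j, hlt⟩ = j := by
    ext
    simp [Fin.coe_modNat, mul_comm _ m, Nat.mod_eq_of_lt]
  simp only [FairInstance.input]
  rw [dif_pos hlt, hdiv, hmod]

lemma runs_orderProgram :
    Runs orderProgram I.input
      (fun s => ∃ τ : Equiv.Perm (Fin n), (∀ i : Fin n, s.nmem i = τ i) ∧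
        Antitone fun i => I.value (τ i) Finset.univ) (8 * (n + m + 1) ^ 2) := by
  set s₁ := (Instr.nconst 3 1).apply ((Instr.nconst 2 1).apply I.input)
  refine (Runs.instr_seq (.instr_seq ((runs_loop_rowSumsBody (s := s₁) rfl rfl rfl).seq
    (T' := 1 + (n * (n * 7 + 8) + 1)) fun s₂ h₂ => .instr_seq ?_))).mono (fun _ h => h) ?_
  · set s₃ := (Instr.nconst 3 1).apply s₂
    have hs₃_nreg (x : ℕ) (hx : x ≤ 2) : s₃.nreg x = s₁.nreg x :=
      (Function.update_of_ne (by omega) _ _).trans (h₂.nreg_of_le x hx)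
    have hranks := runs_loop_ranksBody (s := s₃) (hs₃_nreg 2 le_rfl) rfl
    rw [hs₃_nreg 0 (by simp)] at hranks
    refine hranks.mono (fun s h => ?_) le_rfl
    obtain ⟨τ, hτ, hanti⟩ := exists_perm_rank s₂.rmem n
    have hsum (a : Fin n) : s₂.rmem a = I.value a Finset.univ :=
      (h₂.rmem_of_lt a a.isLt).trans (I.sum_rmem_input a)
    refine ⟨τ, fun i => ?_, by simpa only [hsum] using hanti⟩
    have hnmem := h.nmem_rank (τ i) (τ i).isLt
    rw [hs₃_nreg 0 (by simp)] at hnmem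
    rw [← hnmem]
    exact congrArg s.nmem (hτ i).symm
  · change 1 + (1 + (n * (m * 5 + 7) + 1 + (1 + (n * (n * 7 + 8) + 1)))) ≤ _
    nlinarith

end Input

theorem mainTheorem10 :
    ∃ (prog : Program) (T : Polynomial ℕ), ∀ (n m : ℕ) (I : FairInstance n m),
      ∃ τ : Equiv.Perm (Fin n),
        prog.ComputesOrder I τ (T.eval (n + m)) ∧
        ∀ choose : ChoiceRule n m, I.Rational choose →
          ∀ i : Fin n,
            I.prop (τ i) - 2 * (stageOf n ((i : ℕ) + 1) : ℝ) - 2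
              ≤ I.value (τ i) (I.received choose τ i) := by
  refine ⟨orderProgram, 8 * (Polynomial.X + 1) ^ 2, fun n m I => ?_⟩
  obtain ⟨s, t, hexec, ht, τ, hτ, hanti⟩ := runs_orderProgram I
  refine ⟨τ, ⟨s, t, hexec, by simpa using ht, hτ⟩, fun choose hch i => ?_⟩
  linarith [I.prop_sub_le_value_received hch hanti i]
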